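/- Let $n\ge 1$, let $\mathcal X$ be a complex manifold of dimension $n+1$, and let $\Delta=\{t\in\mathbb C: |t|<1\}$. Let $f:\mathcal X\to\Delta$ be a flat holomorphic map which is smooth (a submersion) over $\Delta\setminus\{0\}$, and let $X_0=f^{-1}(0)$ be its central fibre, a complex space with structure sheaf $\mathcal O_{X_0}=\mathcal O_{\mathcal X}/(f)$. Assume that $X_0$ is singular and that its singularities are isolated, where the singular points of $X_0$ are the points of $X_0$ at which $f$ is not a submersion. Thus $f$ is a smoothing of $X_0$ with smooth total space. Let $\Omega^1_{\mathcal X}|_{X_0}=\Omega^1_{\mathcal X}/f\,\Omega^1_{\mathcal X}$, let $\Omega^1_{X_0}$ be the cokernel of $\mathcal O_{X_0}\to\Omega^1_{\mathcal X}|_{X_0}$, $1\mapsto df$, and let $$\delta:\operatorname{Ext}^1_{\mathcal O_{X_0}}(\Omega^1_{X_0},\mathcal O_{X_0})\longrightarrow H^0\big(X_0,\mathcal{E}xt^1_{\mathcal O_{X_0}}(\Omega^1_{X_0},\mathcal O_{X_0})\big)$$ be the edge homomorphism of the local-to-global spectral sequence. Here $\mathcal{E}xt^1_{\mathcal O_{X_0}}(\mathcal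 F,\mathcal G)$ is the sheaf associated with the presheaf $U\mapsto\operatorname{Ext}^1_{\mathcal O_U}(\mathcal F|_U,\mathcal G|_U)$, and $\delta$ sends an extension class to the global section defined by its restrictions. Then the conormal sequence $$0\to\mathcal O_{X_0}\cong\mathcal I/\mathcal I^2\xrightarrow{\ 1\mapsto df\ }\Omega^1_{\mathcal X}|_{X_0}\to\Omega^1_{X_0}\to 0,\qquad \mathcal I=(f),$$ is exact, and its extension class, the Kodaira–Spencer class $\xi\in\operatorname{Ext}^1_{\mathcal O_{X_0}}(\Omega^1_{X_0},\mathcal O_{X_0})$ of the smoothing, satisfies $\delta(\xi)\neq 0$. -/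

import Mathlib

open CategoryTheory Limits TopologicalSpace Opposite Topology
open scoped Manifold ContDiff

/-! ## Extensions in abelian categories -/

section ExtOne

universe w w' v v' u u'

open DerivedCategory Pretriangulated Abelian

/-- Every class in `Ext¹(X, Y)` is the class of a short exact sequence `0 → Y → E → X → 0`. -/
lemma exists_shortExact_extClass_eq {C : Type u} [Category.{v} C] [Abelian C] [HasExt.{w} C] {X Y : C} (α : Ext X Y 1) :
    ∃ (E : C) (i : Y ⟶ E) (p : E ⟶ X) (w : i ≫ p = 0)
      (h : (ShortComplex.mk i p w).ShortExact), α = h.extClass := by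
  let := HasDerivedCategory.standard C
  obtain ⟨a, ha⟩ : ∃ a : (singleFunctor C 0).obj X ⟶ ((singleFunctor C 0).obj Y)⟦(1:ℤ)⟧,
    a = α.hom := ⟨_, rfl⟩
  obtain ⟨E', i', p', hT⟩ := distinguished_cocone_triangle₂
    a
  have : E'.IsLE 0 := TStructure.t.isLE₂ _ hT 0 (inferInstanceAs (((singleFunctor C 0).obj Y).IsLE 0))
    (inferInstanceAs (((singleFunctor C 0).obj X).IsLE 0))
  have : E'.IsGE 0 := TStructure.t.isGE₂ _ hT 0 (inferInstanceAs (((singleFunctor C 0).obj Y).IsGE 0))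
    (inferInstanceAs (((singleFunctor C 0).obj X).IsGE 0))
  obtain ⟨E, ⟨e⟩⟩ := exists_iso_singleFunctor_obj_of_isGE_of_isLE E' 0
  obtain ⟨i, hi⟩ := (singleFunctor C 0).map_surjective (i' ≫ e.hom)
  obtain ⟨p, hp⟩ := (singleFunctor C 0).map_surjective (e.inv ≫ p')
  let T : Triangle (DerivedCategory C) :=
    Triangle.mk ((singleFunctor C 0).map i) ((singleFunctor C 0).map p) a
  have hT' : T ∈ distTriang (DerivedCategory C) := by
    refine isomorphic_distinguished _ hT _ (Triangle.isoMk _ _ (Iso.refl _) e.symm (Iso.refl _) ?_ ?_ ?_)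
    · change (singleFunctor C 0).map i ≫ e.inv = 𝟙 _ ≫ i'
      simp [hi]
    · change (singleFunctor C 0).map p ≫ 𝟙 _ = e.inv ≫ p'
      simp [hp]
    · change a ≫ (𝟙 _)⟦1⟧' = 𝟙 _ ≫ a
      simp
  have w : i ≫ p = 0 := by
    apply (singleFunctor C 0).map_injective
    rw [Functor.map_comp, Functor.map_zero]
    exact comp_distTriang_mor_zero₁₂ _ hT'
  have hmono : Mono ((homologyFunctor C 0).map T.mor₁) := by
    rw [HomologySequence.mono_homologyMap_mor₁_iff T hT' (-1) 0 (by lia)]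
    exact (isZero_of_isGE ((singleFunctor C 0).obj X) 0 (-1) (by lia)).eq_of_src _ _ 
  have hepi : Epi ((homologyFunctor C 0).map T.mor₂) := by
    rw [HomologySequence.epi_homologyMap_mor₂_iff T hT' 0 1 (by lia)]
    exact (isZero_of_isLE ((singleFunctor C 0).obj Y) 0 1 (by lia)).eq_of_tgt _ _ 
  have hex := HomologySequence.exact₂ T hT' 0
  let ι := singleFunctorCompHomologyFunctorIso C 0
  have h : (ShortComplex.mk i p w).ShortExact := by
    refine ShortComplex.shortExact_of_iso (ShortComplex.isoMk (ι.app Y) (ι.app E) (ι.app X) ?_ ?_)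
      (ShortComplex.ShortExact.mk' hex hmono hepi)
    · exact (ι.hom.naturality i).symm
    · exact (ι.hom.naturality p).symm
  refine ⟨E, i, p, w, h, ?_⟩
  ext
  rw [h.extClass_hom]
  obtain ⟨c, hc1, hc2⟩ := complete_distinguished_triangle_morphism T h.singleTriangle hT'
    h.singleTriangle_distinguished (𝟙 _) (𝟙 _)
    ((Category.comp_id _).trans (Category.id_comp _).symm)
  obtain ⟨c', rfl⟩ := (singleFunctor C 0).map_surjective c
  have hp1 : p ≫ c' = p ≫ 𝟙 X := by
    apply (singleFunctor C 0).map_injective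
    rw [Functor.map_comp, Category.comp_id]
    exact hc1.trans (Category.id_comp _)
  have := h.epi_g
  have hc' : c' = 𝟙 X := by
    dsimp at this
    rwa [cancel_epi] at hp1
  subst hc'
  rw [← ha]
  have h1 : a ≫ (𝟙 ((singleFunctor C 0).obj Y))⟦(1 : ℤ)⟧' =
    (singleFunctor C 0).map (𝟙 X) ≫ h.singleδ := hc2
  simpa using h1

variable {C : Type u} [Category.{v} C] [Abelian C] [HasExt.{w} C]
  {D : Type u'} [Category.{v'} D] [Abelian D] [HasExt.{w'} D]

/-- Exact functors act on `Ext¹` compatibly with natural transformations. -/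
lemma mapExactFunctor_naturality (F G : C ⥤ D) [F.Additive] [PreservesFiniteLimits F]
    [PreservesFiniteColimits F] [G.Additive] [PreservesFiniteLimits G] [PreservesFiniteColimits G]
    (τ : F ⟶ G) {X Y : C} (α : Ext.{w} X Y 1) :
    (α.mapExactFunctor F : Ext.{w'} _ _ 1).comp (Ext.mk₀ (τ.app Y)) (add_zero 1) =
      (Ext.mk₀ (τ.app X)).comp (α.mapExactFunctor G) (zero_add 1) := by
  obtain ⟨E, i, p, w, h, rfl⟩ := exists_shortExact_extClass_eq α
  rw [Ext.mapExactFunctor_extClass, Ext.mapExactFunctor_extClass]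
  exact ShortComplex.ShortExact.extClass_naturality (h.map_of_exact F) (h.map_of_exact G)
    ((ShortComplex.mk i p w).mapNatTrans τ)

lemma mapExactFunctor_id {X Y : C} (α : Ext.{w} X Y 1) : α.mapExactFunctor (𝟭 C) = α := by
  obtain ⟨E, i, p, w, h, rfl⟩ := exists_shortExact_extClass_eq α
  exact Ext.mapExactFunctor_extClass (𝟭 C) h

lemma mapExactFunctor_comp_functor {D' : Type*} [Category* D'] [Abelian D'] [HasExt.{w'} D']
    (F : C ⥤ D) (G : D ⥤ D') [F.Additive] [PreservesFiniteLimits F]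
    [PreservesFiniteColimits F] [G.Additive] [PreservesFiniteLimits G] [PreservesFiniteColimits G]
    {X Y : C} (α : Ext.{w} X Y 1) :
    (α.mapExactFunctor (F ⋙ G) : Ext.{w'} _ _ 1) =
      ((α.mapExactFunctor F : Ext.{w'} _ _ 1).mapExactFunctor G) := by
  obtain ⟨E, i, p, w, h, rfl⟩ := exists_shortExact_extClass_eq α
  have h₁ := Ext.mapExactFunctor_extClass (F ⋙ G) h
  have h₂ := Ext.mapExactFunctor_extClass G (h.map_of_exact F)
  rw [Ext.mapExactFunctor_extClass F h]
  exact h₁.trans h₂.symm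

lemma mk₀_comp_cancel {X Y Z : C} (f : X ⟶ Y) [IsIso f] {n : ℕ} {α β : Ext.{w} Y Z n}
    (h : (Ext.mk₀ f).comp α (zero_add n) = (Ext.mk₀ f).comp β (zero_add n)) : α = β := by
  have := congr((Ext.mk₀ (inv f)).comp $h (zero_add n))
  simpa [Ext.mk₀_comp_mk₀_assoc] using this

/-- The map `Ext¹(X, Y) → Ext¹(X', Y')` given by an exact functor `F` and identifications
`F X ≅ X'` and `F Y ≅ Y'`. -/
noncomputable def extMap (F : C ⥤ D) [F.Additive] [PreservesFiniteLimits F]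
    [PreservesFiniteColimits F] {X Y : C} {X' Y' : D} (a : F.obj X ≅ X') (b : F.obj Y ≅ Y') :
    Ext.{w} X Y 1 →+ Ext.{w'} X' Y' 1 where
  toFun α := (Ext.mk₀ a.inv).comp ((α.mapExactFunctor F).comp (Ext.mk₀ b.hom) (add_zero 1))
    (zero_add 1)
  map_zero' := by simp
  map_add' α β := by simp

lemma extMap_spec (F : C ⥤ D) [F.Additive] [PreservesFiniteLimits F]
    [PreservesFiniteColimits F] {X Y : C} {X' Y' : D} (a : F.obj X ≅ X') (b : F.obj Y ≅ Y')
    (α : Ext.{w} X Y 1) :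
    (Ext.mk₀ a.hom).comp (extMap F a b α : Ext.{w'} X' Y' 1) (zero_add 1) =
      (α.mapExactFunctor F).comp (Ext.mk₀ b.hom) (add_zero 1) := by
  refine (Ext.mk₀_comp_mk₀_assoc _ _ _).trans ?_
  rw [Iso.hom_inv_id]
  exact Ext.mk₀_id_comp _

lemma extMap_id (F : C ⥤ C) [F.Additive] [PreservesFiniteLimits F]
    [PreservesFiniteColimits F] (τ : F ≅ 𝟭 C) {X Y : C} (a : F.obj X ≅ X) (b : F.obj Y ≅ Y)
    (ha : τ.hom.app X = a.hom) (hb : τ.hom.app Y = b.hom) (α : Ext.{w} X Y 1) :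
    extMap F a b α = α := by
  have h := mapExactFunctor_naturality F (𝟭 C) τ.hom α
  rw [mapExactFunctor_id, ha, hb] at h
  exact mk₀_comp_cancel a.hom ((extMap_spec F a b α).trans h)

lemma extMap_comp {D' : Type*} [Category* D'] [Abelian D'] [HasExt.{w'} D']
    (F : C ⥤ D) (G : D ⥤ D') (H : C ⥤ D') [F.Additive] [PreservesFiniteLimits F]
    [PreservesFiniteColimits F] [G.Additive] [PreservesFiniteLimits G] [PreservesFiniteColimits G]
    [H.Additive] [PreservesFiniteLimits H] [PreservesFiniteColimits H] (τ : F ⋙ G ≅ H)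
    {X Y : C} {X' Y' : D} {X'' Y'' : D'} (a : F.obj X ≅ X') (b : F.obj Y ≅ Y')
    (a' : G.obj X' ≅ X'') (b' : G.obj Y' ≅ Y'') (a'' : H.obj X ≅ X'') (b'' : H.obj Y ≅ Y'')
    (ha : τ.hom.app X ≫ a''.hom = G.map a.hom ≫ a'.hom)
    (hb : τ.hom.app Y ≫ b''.hom = G.map b.hom ≫ b'.hom) (α : Ext.{w} X Y 1) :
    (extMap H a'' b'' α : Ext.{w'} X'' Y'' 1) =
      extMap G a' b' (extMap F a b α : Ext.{w'} X' Y' 1) := by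
  have h := mapExactFunctor_naturality (F ⋙ G) H τ.hom α (D := D')
  rw [mapExactFunctor_comp_functor F G] at h
  have h₁ := extMap_spec H a'' b'' α (D := D')
  have h₂ := extMap_spec G a' b' (extMap F a b α : Ext.{w'} X' Y' 1) (D := D')
  have h₃ := congr(Ext.mapExactFunctor G $(extMap_spec F a b α (D := D)))
  rw [Ext.mapExactFunctor_comp, Ext.mapExactFunctor_comp, Ext.mapExactFunctor_mk₀,
    Ext.mapExactFunctor_mk₀] at h₃
  refine mk₀_comp_cancel (τ.hom.app X ≫ a''.hom) ?_
  have e₁ := calc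
    (Ext.mk₀ (τ.hom.app X ≫ a''.hom)).comp (extMap H a'' b'' α : Ext.{w'} X'' Y'' 1) (zero_add 1)
    _ = (Ext.mk₀ (τ.hom.app X)).comp ((Ext.mk₀ a''.hom).comp
          (extMap H a'' b'' α : Ext.{w'} X'' Y'' 1) (zero_add 1)) (zero_add 1) :=
        (Ext.mk₀_comp_mk₀_assoc _ _ _).symm
    _ = (Ext.mk₀ (τ.hom.app X)).comp ((Ext.mapExactFunctor H α).comp (Ext.mk₀ b''.hom)
          (add_zero 1)) (zero_add 1) := by rw [h₁]
    _ = ((Ext.mk₀ (τ.hom.app X)).comp (Ext.mapExactFunctor H α) (zero_add 1)).comp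
          (Ext.mk₀ b''.hom) (add_zero 1) := (Ext.comp_assoc_of_third_deg_zero _ _ _ _).symm
    _ = (((Ext.mapExactFunctor G (Ext.mapExactFunctor F α : Ext.{w'} _ _ 1)).comp
          (Ext.mk₀ (τ.hom.app Y)) (add_zero 1))).comp (Ext.mk₀ b''.hom) (add_zero 1) :=
        congr(Ext.comp $(h.symm) (Ext.mk₀ b''.hom) (add_zero 1))
    _ = (Ext.mapExactFunctor G (Ext.mapExactFunctor F α : Ext.{w'} _ _ 1)).comp
          (Ext.mk₀ (τ.hom.app Y ≫ b''.hom)) (add_zero 1) := by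
        rw [← Ext.mk₀_comp_mk₀]
        exact Ext.comp_assoc_of_third_deg_zero _ _ _ _
  have e₂ := calc
    (Ext.mk₀ (G.map a.hom ≫ a'.hom)).comp
        (extMap G a' b' (extMap F a b α : Ext.{w'} X' Y' 1) : Ext.{w'} X'' Y'' 1) (zero_add 1)
    _ = (Ext.mk₀ (G.map a.hom)).comp ((Ext.mk₀ a'.hom).comp
          (extMap G a' b' (extMap F a b α : Ext.{w'} X' Y' 1) : Ext.{w'} X'' Y'' 1) (zero_add 1))
          (zero_add 1) := (Ext.mk₀_comp_mk₀_assoc _ _ _).symm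
    _ = (Ext.mk₀ (G.map a.hom)).comp ((Ext.mapExactFunctor G
          (extMap F a b α : Ext.{w'} X' Y' 1)).comp (Ext.mk₀ b'.hom) (add_zero 1))
          (zero_add 1) := by rw [h₂]
    _ = ((Ext.mk₀ (G.map a.hom)).comp (Ext.mapExactFunctor G
          (extMap F a b α : Ext.{w'} X' Y' 1)) (zero_add 1)).comp (Ext.mk₀ b'.hom) (add_zero 1) :=
        (Ext.comp_assoc_of_third_deg_zero _ _ _ _).symm
    _ = ((Ext.mapExactFunctor G (Ext.mapExactFunctor F α : Ext.{w'} _ _ 1)).comp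
          (Ext.mk₀ (G.map b.hom)) (add_zero 1)).comp (Ext.mk₀ b'.hom) (add_zero 1) := by
        rw [h₃]
    _ = (Ext.mapExactFunctor G (Ext.mapExactFunctor F α : Ext.{w'} _ _ 1)).comp
          (Ext.mk₀ (G.map b.hom ≫ b'.hom)) (add_zero 1) := by
        rw [← Ext.mk₀_comp_mk₀]
        exact Ext.comp_assoc_of_third_deg_zero _ _ _ _
  rw [e₁, ha, hb]
  exact e₂.symm

end ExtOne

/-! ## Restriction of sheaves of modules to open subsets, and the sheaf `Ext¹` -/

section SheafExt

universe u

open Abelian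

namespace SheafOfModules

variable {X : TopCat.{u}} {R : Sheaf (Opens.grothendieckTopology X) RingCat.{u}}

section

variable {C : Type u} [Category.{u} C] {J : GrothendieckTopology C} {S : Sheaf J RingCat.{u}}
  {A B : SheafOfModules.{u} S} (f : A ⟶ B)

lemma mono_of_injective_app (h : ∀ U, Function.Injective (f.val.app U)) : Mono f :=
  have : Mono ((SheafOfModules.forget S).map f) :=
    PresheafOfModules.mono_of_injective (fun U => h U)
  (SheafOfModules.forget S).mono_of_mono_map this

lemma injective_app_of_mono [Mono f] (U : Cᵒᵖ) : Function.Injective (f.val.app U) :=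
  have : Mono ((SheafOfModules.evaluation S U).map f) := inferInstance
  (ModuleCat.mono_iff_injective _).1 this

end

lemma preservesFiniteLimits_of_additive {A B : Type*} [Category* A] [Category* B] [Abelian A]
    [Abelian B] (F : A ⥤ B) [F.Additive] [F.IsLeftAdjoint] [F.PreservesMonomorphisms] :
    PreservesFiniteLimits F :=
  by
    refine (List.TFAE.out (Functor.preservesFiniteLimits_tfae F) 0 3).1 ?_
    intro S hS
    have hF : PreservesFiniteColimits F := inferInstance
    have := hS.mono_f
    have h := (List.TFAE.out (Functor.preservesFiniteColimits_tfae F) 0 3).2 hF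
    exact ⟨(h S hS).1, inferInstance⟩

variable (R)

instance (U : Opens X) : (overFunctor.{u} R U).Additive where
  map_add := rfl

instance (U : Opens X) : (overFunctor.{u} R U).PreservesMonomorphisms where
  preserves f _ := mono_of_injective_app _ fun _ => injective_app_of_mono f _

instance (U : Opens X) : (overFunctor.{u} R U).IsLeftAdjoint := by
  unfold overFunctor
  infer_instance

instance (U : Opens X) : PreservesFiniteLimits (overFunctor.{u} R U) :=
  preservesFiniteLimits_of_additive _

instance (U : Opens X) : PreservesFiniteColimits (overFunctor.{u} R U) :=
  inferInstance

instance {U V : Opens X} (i : U ⟶ V) : (overMap.{u} R i).Additive where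
  map_add := rfl

instance {U V : Opens X} (i : U ⟶ V) : (overMap.{u} R i).PreservesMonomorphisms where
  preserves f _ := mono_of_injective_app _ fun _ => injective_app_of_mono f _

instance {U V : Opens X} (i : U ⟶ V) : PreservesFiniteLimits (overMap.{u} R i) :=
  preservesFiniteLimits_of_additive _

instance {U V : Opens X} (i : U ⟶ V) : PreservesFiniteColimits (overMap.{u} R i) :=
  inferInstance


/-- Restricting from `U` to `U` does nothing. -/
noncomputable def overMapId (U : Opens X) : overMap.{u} R (𝟙 U) ≅ 𝟭 _ :=
  pushforwardCongr₂ (ψ := 𝟙 _) (F := 𝟭 _) _ (Over.mapId U).symm (by ext V x; exact congr($(R.obj.map_id (op V.unop.left)) x)) ≪≫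
    pushforwardId _

/-- Restricting from `U` to `V` and then to `W` is restricting from `U` to `W`. -/
noncomputable def overMapComp {U V W : Opens X} (i : V ⟶ U) (j : W ⟶ V) :
    overMap.{u} R i ⋙ overMap.{u} R j ≅ overMap.{u} R (j ≫ i) :=
  haveI : (Over.map j ⋙ Over.map i).IsContinuous ((Opens.grothendieckTopology X).over W)
    ((Opens.grothendieckTopology X).over U) :=
    Functor.isContinuous_comp _ _ _ ((Opens.grothendieckTopology X).over V) _
  pushforwardComp _ _ ≪≫
    pushforwardCongr₂ (F := Over.map (j ≫ i)) _ (Over.mapComp j i) (by ext V x; exact congr($(R.obj.map_id (op V.unop.left)) x))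

lemma overMapId_hom_app (U : Opens X) (M : SheafOfModules.{u} R) :
    (overMapId R U).hom.app (M.over U) = (overFunctorMap R (𝟙 U)).hom.app M := by
  ext V x
  exact congr($(M.val.presheaf.map_id (op V.unop.left)) x)

lemma overMapComp_hom_app {U V W : Opens X} (i : V ⟶ U) (j : W ⟶ V) (M : SheafOfModules.{u} R) :
    (overMapComp R i j).hom.app (M.over U) ≫ (overFunctorMap R (j ≫ i)).hom.app M =
      (overMap R j).map ((overFunctorMap R i).hom.app M) ≫ (overFunctorMap R j).hom.app M := by
  ext V x
  exact congr($(M.val.presheaf.map_id (op V.unop.left)) x)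


attribute [local instance] HasExt.standard

variable {R}
variable (F G : SheafOfModules.{u} R)

/-- The restriction map `Ext¹(F|_U, G|_U) → Ext¹(F|_V, G|_V)` for `V ⊆ U`. -/
noncomputable def extRestrict {U V : Opens X} (i : V ⟶ U) :
    Ext.{u + 1} (F.over U) (G.over U) 1 →+ Ext.{u + 1} (F.over V) (G.over V) 1 :=
  extMap (C := SheafOfModules.{u} (R.over U)) (D := SheafOfModules.{u} (R.over V))
    (X := F.over U) (Y := G.over U) (X' := F.over V) (Y' := G.over V) (overMap.{u} R i)
    ((overFunctorMap R i).app F) ((overFunctorMap R i).app G)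

lemma extRestrict_id (U : Opens X) (α : Ext.{u + 1} (F.over U) (G.over U) 1) :
    extRestrict F G (𝟙 U) α = α :=
  extMap_id _ (overMapId R U) _ _ (overMapId_hom_app R U F) (overMapId_hom_app R U G) α

lemma extRestrict_comp {U V W : Opens X} (i : V ⟶ U) (j : W ⟶ V)
    (α : Ext.{u + 1} (F.over U) (G.over U) 1) :
    extRestrict F G (j ≫ i) α = extRestrict F G j (extRestrict F G i α) :=
  extMap_comp _ _ _ (overMapComp R i j) _ _ _ _ _ _ (overMapComp_hom_app R i j F)
    (overMapComp_hom_app R i j G) α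

/-- The presheaf `U ↦ Ext¹(F|_U, G|_U)` of abelian groups. -/
noncomputable def extPresheaf : (Opens X)ᵒᵖ ⥤ AddCommGrpCat.{u + 1} where
  obj U := AddCommGrpCat.of (Ext.{u + 1} (F.over U.unop) (G.over U.unop) 1)
  map i := AddCommGrpCat.ofHom (extRestrict F G i.unop)
  map_id U := by
    ext α
    exact extRestrict_id F G _ α
  map_comp i j := by
    ext α
    exact extRestrict_comp F G _ _ α

instance : PreservesFilteredColimitsOfSize.{u, u} (CategoryTheory.forget AddCommGrpCat.{u + 1}) :=
  preservesFilteredColimitsOfSize_shrink.{u, u + 1, u, u + 1} _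

/-- The sheaf `ℰxt¹(F, G)`: the sheaf associated with the presheaf `U ↦ Ext¹(F|_U, G|_U)`. -/
noncomputable def sheafExt : Sheaf (Opens.grothendieckTopology X) AddCommGrpCat.{u + 1} :=
  (presheafToSheaf (Opens.grothendieckTopology X) AddCommGrpCat.{u + 1}).obj (extPresheaf F G)

/-- The edge homomorphism `δ : Ext¹(F, G) → H⁰(X, ℰxt¹(F, G))` of the local-to-global
spectral sequence: a class is sent to the global section given by its restrictions. -/
noncomputable def localToGlobal :
    Ext.{u + 1} F G 1 →+ (sheafExt F G).obj.obj (op ⊤) :=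
  ((toSheafify (Opens.grothendieckTopology X) (extPresheaf F G)).app (op ⊤)).hom.comp
    ((overFunctor R ⊤).mapExtAddHom F G 1)

end SheafOfModules

end SheafExt

/-! ## Sheaves of locally representable families of germs -/

section StalkwiseSheaf

universe u

variable {X : TopCat.{u}}

/-- Given a relation `rel g x a`, read "`g` represents `a` at the point `x`", a family of elements
`s y` indexed by the points `y` of an open set is a section if near each point it is represented
by a single `g`. -/
def representablePredicate {T : X → Type u} {Γ : Type u} (rel : Γ → (x : X) → T x → Prop) :
    TopCat.LocalPredicate T where
  pred {U} s := ∀ x : U, ∃ g : Γ, ∀ᶠ y in 𝓝 x, rel g y.1 (s y)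
  res {U V} i s hs x := by
    obtain ⟨g, hg⟩ := hs (i x)
    have hc : Continuous (fun x : U ↦ (i x : V)) := continuous_inclusion i.le
    exact ⟨g, hc.continuousAt.eventually hg⟩
  locality {U} s hs x := by
    obtain ⟨V, hV, i, h⟩ := hs x
    obtain ⟨g, hg⟩ := h ⟨x.1, hV⟩
    refine ⟨g, ?_⟩
    have := (Opens.isOpenEmbedding_of_le i.le).map_nhds_eq ⟨x.1, hV⟩
    change Filter.map _ _ = 𝓝 x at this
    rw [← this]
    exact hg

end StalkwiseSheaf

/-! ## Germs of holomorphic functions and of holomorphic one-forms -/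

section Germs

open Filter

variable (E : Type*) [NormedAddCommGroup E] [NormedSpace ℂ E]
  {M : Type*} [TopologicalSpace M] [ChartedSpace E M]

/-- `g` is holomorphic (that is, complex analytic) at `x`, and hence near `x`. -/
def HolomorphicAt (g : M → ℂ) (x : M) : Prop := ContMDiffAt 𝓘(ℂ, E) 𝓘(ℂ) ω g x

/-- The space of covectors on `E`. -/
def Covector : Type _ := E →L[ℂ] ℂ

noncomputable instance : NormedAddCommGroup (Covector E) :=
  inferInstanceAs (NormedAddCommGroup (E →L[ℂ] ℂ))

noncomputable instance : NormedSpace ℂ (Covector E) :=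
  inferInstanceAs (NormedSpace ℂ (E →L[ℂ] ℂ))

/-- The differential of `g` at `y`, as a covector in the preferred chart at `y`. -/
noncomputable def differential (g : M → ℂ) (y : M) : Covector E := mfderiv 𝓘(ℂ, E) 𝓘(ℂ) g y

/-- The local ring `𝒪_{M,x}` of germs of holomorphic functions at `x`. -/
noncomputable def holGerms (x : M) : Subring (Germ (𝓝 x) ℂ) where
  carrier := {γ | ∃ g : M → ℂ, HolomorphicAt E g x ∧ (g : Germ (𝓝 x) ℂ) = γ}
  one_mem' := ⟨1, contMDiffAt_const, rfl⟩
  zero_mem' := ⟨0, contMDiffAt_const, rfl⟩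
  neg_mem' := by
    rintro _ ⟨g, hg, rfl⟩
    exact ⟨-g, ContMDiffAt.neg hg, rfl⟩
  add_mem' := by
    rintro _ _ ⟨g, hg, rfl⟩ ⟨g', hg', rfl⟩
    exact ⟨g + g', ContMDiffAt.add hg hg', rfl⟩
  mul_mem' := by
    rintro _ _ ⟨g, hg, rfl⟩ ⟨g', hg', rfl⟩
    exact ⟨g * g', ContMDiffAt.mul hg hg', rfl⟩

/-- The `𝒪_{M,x}`-module `Ω_{M,x}` of germs of holomorphic one-forms at `x`: it is generated by
the differentials of holomorphic functions. -/
noncomputable def formGerms (x : M) : Submodule (holGerms E x) (Germ (𝓝 x) (Covector E)) :=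
  Submodule.span _ {γ | ∃ g : M → ℂ, HolomorphicAt E g x ∧
    (differential E g : Germ (𝓝 x) (Covector E)) = γ}

/-- The homomorphism `𝒪_{ℂ,f(x)} → 𝒪_{M,x}`, `g ↦ g ∘ f`. -/
noncomputable def holGermsComap {f : M → ℂ} {x : M} (hf : HolomorphicAt E f x) :
    holGerms ℂ (f x) →+* holGerms E x where
  toFun γ := ⟨γ.1.compTendsto f (ContMDiffAt.continuousAt hf), by
    obtain ⟨_, g, hg, rfl⟩ := γ
    exact ⟨g ∘ f, ContMDiffAt.comp x hg hf, rfl⟩⟩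
  map_one' := rfl
  map_zero' := rfl
  map_add' := by
    rintro ⟨_, g, hg, rfl⟩ ⟨_, g', hg', rfl⟩
    rfl
  map_mul' := by
    rintro ⟨_, g, hg, rfl⟩ ⟨_, g', hg', rfl⟩
    rfl

end Germs

/-! ## Smoothings with smooth total space -/

section Smoothing

universe u

/-- The model space `ℂⁿ⁺¹`. -/
abbrev AffineModel (n : ℕ) : Type := EuclideanSpace ℂ (Fin (n + 1))

/-- A one-parameter degeneration `f : M → Δ` over the unit disk `Δ ⊆ ℂ` whose total space is the
complex manifold `M` of dimension `n + 1`: `f` is holomorphic with values in `Δ`, flat, and smooth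
(a submersion) over `Δ \ {0}`. It is a smoothing of its central fibre `X₀ = f⁻¹(0)`. -/
structure Smoothing (n : ℕ) (M : Type u) [TopologicalSpace M]
    [ChartedSpace (AffineModel n) M] where
  /-- the projection to the disk -/
  f : M → ℂ
  holomorphic : ∀ x, HolomorphicAt (AffineModel n) f x
  mem_disk : ∀ x, ‖f x‖ < 1
  flat : ∀ x, (holGermsComap _ (holomorphic x)).Flat
  submersion : ∀ x, f x ≠ 0 →
    Function.Surjective (mfderiv 𝓘(ℂ, AffineModel n) 𝓘(ℂ) f x)

namespace Smoothing

variable {n : ℕ} {M : Type u} [TopologicalSpace M]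
  [ChartedSpace (AffineModel n) M] (𝔛 : Smoothing n M)

/-- The topological space underlying the central fibre `X₀ = f⁻¹(0)`. -/
def fiber : TopCat.{u} := TopCat.of {x : M // 𝔛.f x = 0}

/-- The point of `M` underlying a point of `X₀`. -/
def pt (x : 𝔛.fiber) : M := x.1

/-- The singular points of `X₀`: the points of `X₀` at which `f` is not a submersion. -/
def singularPoints : Set 𝔛.fiber := {p | ¬ Function.Surjective (mfderiv 𝓘(ℂ, AffineModel n) 𝓘(ℂ) 𝔛.f (𝔛.pt p))}

/-- `X₀` has isolated singularities: near a singular point there is no other singular point. -/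
def HasIsolatedSingularities : Prop :=
  ∀ p ∈ 𝔛.singularPoints, ∀ᶠ q in 𝓝[≠] p, q ∉ 𝔛.singularPoints

/-- The stalk at `x` of the ideal sheaf `I = (f)` of `X₀`. -/
noncomputable def idealStalk (x : 𝔛.fiber) : Ideal (holGerms (AffineModel n) (𝔛.pt x)) :=
  Ideal.span {⟨𝔛.f, 𝔛.f, 𝔛.holomorphic _, rfl⟩}

/-- The stalk `𝒪_{X₀,x} = 𝒪_{M,x} / I_x`. -/
def ringStalk (x : 𝔛.fiber) : Type u := holGerms (AffineModel n) (𝔛.pt x) ⧸ 𝔛.idealStalk x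

noncomputable instance (x : 𝔛.fiber) : CommRing (𝔛.ringStalk x) :=
  inferInstanceAs (CommRing (holGerms (AffineModel n) (𝔛.pt x) ⧸ 𝔛.idealStalk x))

/-- The submodule `I_x Ω_{M,x}` of `Ω_{M,x}`. -/
noncomputable def idealSmulForms (x : 𝔛.fiber) :
    Submodule (holGerms (AffineModel n) (𝔛.pt x)) (formGerms (AffineModel n) (𝔛.pt x)) :=
  𝔛.idealStalk x • ⊤

/-- The stalk `Ω_{M,x} / I_x Ω_{M,x}` of `Ω_M|_{X₀}`. -/
def formStalk (x : 𝔛.fiber) : Type u := formGerms (AffineModel n) (𝔛.pt x) ⧸ 𝔛.idealSmulForms x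

noncomputable instance (x : 𝔛.fiber) : AddCommGroup (𝔛.formStalk x) :=
  inferInstanceAs (AddCommGroup (formGerms (AffineModel n) (𝔛.pt x) ⧸ 𝔛.idealSmulForms x))

noncomputable instance (x : 𝔛.fiber) : Module (𝔛.ringStalk x) (𝔛.formStalk x) :=
  Module.instQuotientIdealSubmoduleHSMulTop (formGerms (AffineModel n) (𝔛.pt x)) (𝔛.idealStalk x)

/-- The projection `𝒪_{M,x} → 𝒪_{X₀,x}`. -/
noncomputable def ringMk (x : 𝔛.fiber) : holGerms (AffineModel n) (𝔛.pt x) →+* 𝔛.ringStalk x :=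
  Ideal.Quotient.mk _

/-- The projection `Ω_{M,x} → Ω_{M,x} / I_x Ω_{M,x}`. -/
noncomputable def formMk (x : 𝔛.fiber) : formGerms (AffineModel n) (𝔛.pt x) →+ 𝔛.formStalk x :=
  (𝔛.idealSmulForms x).mkQ.toAddMonoidHom

lemma formMk_smul (x : 𝔛.fiber) (r : holGerms (AffineModel n) (𝔛.pt x)) (θ : formGerms (AffineModel n) (𝔛.pt x)) :
    𝔛.formMk x (r • θ) = 𝔛.ringMk x r • 𝔛.formMk x θ := rfl

/-- The function `g` on `M` is holomorphic at `x` and represents `a` in `𝒪_{X₀,x}`. -/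
def RingRep (g : M → ℂ) (x : 𝔛.fiber) (a : 𝔛.ringStalk x) : Prop :=
  ∃ h : (g : Filter.Germ (𝓝 (𝔛.pt x)) ℂ) ∈ holGerms (AffineModel n) (𝔛.pt x), a = 𝔛.ringMk x ⟨g, h⟩

/-- The one-form `θ` on `M` is holomorphic at `x` and represents `a` in the stalk of `Ω_M|_{X₀}`. -/
def FormRep (θ : M → Covector (AffineModel n)) (x : 𝔛.fiber) (a : 𝔛.formStalk x) : Prop :=
  ∃ h : (θ : Filter.Germ (𝓝 (𝔛.pt x)) (Covector (AffineModel n))) ∈ formGerms (AffineModel n) (𝔛.pt x),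
    a = 𝔛.formMk x ⟨θ, h⟩

/-- The ring `𝒪_{X₀}(U)`: the families of elements of the stalks which are locally represented
by holomorphic functions on `M`. -/
noncomputable def sectionRing (U : Opens 𝔛.fiber) : Subring (∀ x : U, 𝔛.ringStalk x.1) where
  carrier := {s | (representablePredicate 𝔛.RingRep).pred s}
  one_mem' x := ⟨1, .of_forall fun y ↦ ⟨one_mem _, (map_one (𝔛.ringMk y.1)).symm⟩⟩
  zero_mem' x := ⟨0, .of_forall fun y ↦ ⟨zero_mem _, (map_zero (𝔛.ringMk y.1)).symm⟩⟩
  neg_mem' {a} ha x := by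
    obtain ⟨g, hg⟩ := ha x
    refine ⟨-g, hg.mono fun y hy ↦ ?_⟩
    obtain ⟨h, e⟩ := hy
    exact ⟨neg_mem h, by rw [Pi.neg_apply, e]; exact (map_neg (𝔛.ringMk y.1) ⟨g, h⟩).symm⟩
  add_mem' {a b} ha hb x := by
    obtain ⟨g, hg⟩ := ha x
    obtain ⟨g', hg'⟩ := hb x
    refine ⟨g + g', (hg.and hg').mono fun y hy ↦ ?_⟩
    obtain ⟨⟨h, e⟩, ⟨h', e'⟩⟩ := hy
    exact ⟨add_mem h h', by
      rw [Pi.add_apply, e, e']; exact (map_add (𝔛.ringMk y.1) ⟨g, h⟩ ⟨g', h'⟩).symm⟩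
  mul_mem' {a b} ha hb x := by
    obtain ⟨g, hg⟩ := ha x
    obtain ⟨g', hg'⟩ := hb x
    refine ⟨g * g', (hg.and hg').mono fun y hy ↦ ?_⟩
    obtain ⟨⟨h, e⟩, ⟨h', e'⟩⟩ := hy
    exact ⟨mul_mem h h', by
      rw [Pi.mul_apply, e, e']; exact (map_mul (𝔛.ringMk y.1) ⟨g, h⟩ ⟨g', h'⟩).symm⟩

noncomputable instance (U : Opens 𝔛.fiber) :
    Module (𝔛.sectionRing U) (∀ x : U, 𝔛.formStalk x.1) :=
  Module.compHom _ (𝔛.sectionRing U).subtype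

/-- The module `(Ω_M|_{X₀})(U)`: the families of elements of the stalks which are locally
represented by holomorphic one-forms on `M`. -/
noncomputable def sectionModule (U : Opens 𝔛.fiber) :
    Submodule (𝔛.sectionRing U) (∀ x : U, 𝔛.formStalk x.1) where
  carrier := {s | (representablePredicate 𝔛.FormRep).pred s}
  zero_mem' x := ⟨0, .of_forall fun y ↦ ⟨zero_mem _, (map_zero (𝔛.formMk y.1)).symm⟩⟩
  add_mem' {a b} ha hb x := by
    obtain ⟨g, hg⟩ := ha x
    obtain ⟨g', hg'⟩ := hb x
    refine ⟨g + g', (hg.and hg').mono fun y hy ↦ ?_⟩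
    obtain ⟨⟨h, e⟩, ⟨h', e'⟩⟩ := hy
    exact ⟨add_mem h h', by
      rw [Pi.add_apply, e, e']; exact (map_add (𝔛.formMk y.1) ⟨g, h⟩ ⟨g', h'⟩).symm⟩
  smul_mem' r {a} ha x := by
    obtain ⟨g, hg⟩ := r.2 x
    obtain ⟨g', hg'⟩ := ha x
    refine ⟨g • g', (hg.and hg').mono fun y hy ↦ ?_⟩
    obtain ⟨⟨h, e⟩, ⟨h', e'⟩⟩ := hy
    exact ⟨Submodule.smul_mem _ (⟨g, h⟩ : holGerms (AffineModel n) (𝔛.pt y.1)) h', by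
      change r.1 y • a y = _
      rw [e, e']
      exact (𝔛.formMk_smul y.1 ⟨g, h⟩ ⟨g', h'⟩).symm⟩

/-- The structure sheaf `𝒪_{X₀} = 𝒪_M / (f)`, as a sheaf of rings on `X₀`. -/
noncomputable def ringSheaf : Sheaf (Opens.grothendieckTopology 𝔛.fiber) RingCat.{u} where
  obj :=
    { obj U := RingCat.of (𝔛.sectionRing U.unop)
      map i := RingCat.ofHom
        { toFun s := ⟨fun x ↦ s.1 (i.unop x),
            (representablePredicate 𝔛.RingRep).res i.unop s.1 s.2⟩
          map_one' := rfl
          map_mul' _ _ := rfl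
          map_zero' := rfl
          map_add' _ _ := rfl } }
  property := by
    refine (CategoryTheory.Presheaf.isSheaf_iff_isSheaf_forget _ _
      (CategoryTheory.forget RingCat)).2 ?_
    exact (TopCat.subsheafToTypes (representablePredicate 𝔛.RingRep)).2

/-- The presheaf of abelian groups underlying `Ω_M|_{X₀}`. -/
noncomputable def formPresheaf : (Opens 𝔛.fiber)ᵒᵖ ⥤ Ab.{u} where
  obj U := AddCommGrpCat.of (𝔛.sectionModule U.unop)
  map i := AddCommGrpCat.ofHom
    { toFun s := ⟨fun x ↦ s.1 (i.unop x),
        (representablePredicate 𝔛.FormRep).res i.unop s.1 s.2⟩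
      map_zero' := rfl
      map_add' _ _ := rfl }

noncomputable instance (U : (Opens 𝔛.fiber)ᵒᵖ) :
    Module (𝔛.ringSheaf.obj.obj U) (𝔛.formPresheaf.obj U) :=
  inferInstanceAs (Module (𝔛.sectionRing U.unop) (𝔛.sectionModule U.unop))

/-- The sheaf of `𝒪_{X₀}`-modules `Ω_M|_{X₀} = Ω_M / f Ω_M`. -/
noncomputable def ambientForms : SheafOfModules.{u} 𝔛.ringSheaf where
  val := PresheafOfModules.ofPresheaf 𝔛.formPresheaf fun _ _ _ _ _ ↦ rfl
  isSheaf := by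
    refine (CategoryTheory.Presheaf.isSheaf_iff_isSheaf_forget _ _
      (CategoryTheory.forget AddCommGrpCat)).2 ?_
    exact (TopCat.subsheafToTypes (representablePredicate 𝔛.FormRep)).2

/-- The global section `df` of `Ω_M|_{X₀}`. -/
noncomputable def df : 𝔛.ambientForms.sections :=
  PresheafOfModules.sectionsMk
    (fun U ↦ (⟨fun x ↦ 𝔛.formMk x.1 ⟨differential (AffineModel n) 𝔛.f,
        Submodule.subset_span ⟨𝔛.f, 𝔛.holomorphic _, rfl⟩⟩,
      fun _ ↦ ⟨differential (AffineModel n) 𝔛.f, .of_forall fun _ ↦ ⟨_, rfl⟩⟩⟩ : 𝔛.sectionModule U.unop))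
    (fun _ _ _ ↦ rfl)

/-- The structure sheaf of `X₀` as a module over itself. -/
noncomputable abbrev structureSheaf : SheafOfModules.{u} 𝔛.ringSheaf := SheafOfModules.unit _

/-- The conormal map `𝒪_{X₀} ≅ I / I² → Ω_M|_{X₀}`: the generator `1`, which corresponds to the
class of the equation `f`, is sent to `df`. -/
noncomputable def conormalMap : 𝔛.structureSheaf ⟶ 𝔛.ambientForms :=
  (SheafOfModules.unitHomEquiv _).symm 𝔛.df

/-- The sheaf of Kähler differentials `Ω_{X₀}`, that is `Ω_M|_{X₀}` modulo `𝒪_{X₀} ∙ df`. -/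
noncomputable def kaehlerForms : SheafOfModules.{u} 𝔛.ringSheaf := cokernel 𝔛.conormalMap

/-- The conormal sequence `𝒪_{X₀} ≅ I / I² → Ω_M|_{X₀} → Ω_{X₀}`. -/
noncomputable def conormalSequence : ShortComplex (SheafOfModules.{u} 𝔛.ringSheaf) :=
  ShortComplex.mk (X₃ := 𝔛.kaehlerForms) 𝔛.conormalMap (cokernel.π 𝔛.conormalMap)
    (cokernel.condition _)

attribute [local instance] HasExt.standard

open Abelian

/-- The Kodaira–Spencer class in `Ext¹(Ω_{X₀}, 𝒪_{X₀})`: the class of the extension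
`0 → 𝒪_{X₀} → Ω_M|_{X₀} → Ω_{X₀} → 0`. -/
noncomputable def kodairaSpencerClass (h : 𝔛.conormalSequence.ShortExact) :
    Ext.{u + 1} 𝔛.kaehlerForms 𝔛.structureSheaf 1 :=
  h.extClass

end Smoothing

end Smoothing

/-! ## Parameter integrals of analytic functions and Hartogs' theorem -/

/-! Two statements have to be proved: the conormal map is injective, and the extension does not
split near a singular point `p`.

Injectivity. Suppose `g df` lies in `f Ω`. Where `df ≠ 0`, some partial derivative of `f` is a unit,
and comparing coefficients in that direction shows that `f` divides `g`
(`exists_eq_mul_of_smul_differential`). Off the fibre `f` itself is a unit. Since singular points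
are isolated, `g / f` is therefore holomorphic on a punctured neighbourhood of any singular point.
The total space has dimension `n + 1 ≥ 2`, so Hartogs' theorem (`exists_analyticAt_extension`)
extends the quotient across the point, and `g` vanishes in `𝒪_{X₀}`. The extension is a Cauchy
integral along lines in one fixed direction; its analyticity comes from `analyticAt_setIntegral`.

Nonvanishing. If `δ(ξ) = 0`, then `ξ` restricts to zero on a neighbourhood of `p`, because a
presheaf section killed by sheafification is locally zero. The conormal sequence then has a
retraction `ρ` there (`exists_retraction_of_localToGlobal_eq_zero`), so `ρ(df) = 1`. But `df = ∑
(∂f/∂zᵢ) dzᵢ`, and every `∂f/∂zᵢ` vanishes at `p`; by linearity `1 = ∑ (∂f/∂zᵢ) ρ(dzᵢ)` vanishes at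
`p`, which is absurd (`conormalMap_over_comp_ne_id`). -/

section Analysis

open Filter Metric
open scoped BoundedContinuousFunction

/-! ### Superposition operators and analyticity of parameter integrals -/

section Superposition

variable {α V W : Type*} [TopologicalSpace α] [NormedAddCommGroup V] [NormedSpace ℂ V]
  [NormedAddCommGroup W] [NormedSpace ℂ W]

/-- The pointwise action of a continuous multilinear map on bounded continuous functions. -/
noncomputable def ContinuousMultilinearMap.superpose (α : Type*) [TopologicalSpace α] {n : ℕ}
    (m : ContinuousMultilinearMap ℂ (fun _ : Fin n ↦ V) W) :
    ContinuousMultilinearMap ℂ (fun _ : Fin n ↦ α →ᵇ V) (α →ᵇ W) :=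
  have hb (u : Fin n → α →ᵇ V) (a : α) : ‖m fun i ↦ u i a‖ ≤ ‖m‖ * ∏ i, ‖u i‖ :=
    (m.le_opNorm _).trans (by gcongr with i; exact (u i).norm_coe_le_norm a)
  MultilinearMap.mkContinuous
    { toFun u := BoundedContinuousFunction.ofNormedAddCommGroup (fun a ↦ m fun i ↦ u i a)
        (m.cont.comp (continuous_pi fun i ↦ (u i).continuous)) _ (hb u)
      map_update_add' u i x y := by
        ext a
        have e (z : α →ᵇ V) : (fun j ↦ Function.update u i z j a) =
            Function.update (fun j ↦ u j a) i (z a) := by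
          ext j; by_cases h : j = i
          · subst h; simp
          · simp [h]
        simp [e]
      map_update_smul' u i c x := by
        ext a
        have e (z : α →ᵇ V) : (fun j ↦ Function.update u i z j a) =
            Function.update (fun j ↦ u j a) i (z a) := by
          ext j; by_cases h : j = i
          · subst h; simp
          · simp [h]
        simp [e] } ‖m‖ fun u ↦
    (BoundedContinuousFunction.norm_le (by positivity)).2 (hb u)

lemma ContinuousMultilinearMap.norm_superpose_le {n : ℕ}
    (m : ContinuousMultilinearMap ℂ (fun _ : Fin n ↦ V) W) : ‖m.superpose α‖ ≤ ‖m‖ :=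
  ContinuousMultilinearMap.opNorm_le_bound (norm_nonneg _) fun u ↦
    (BoundedContinuousFunction.norm_le (by positivity)).2 fun a ↦
      (m.le_opNorm _).trans (by gcongr with i; exact (u i).norm_coe_le_norm a)

/-- Composition with an analytic map is analytic on bounded continuous functions. -/
lemma AnalyticAt.exists_superposition [CompleteSpace W] (α : Type*) [TopologicalSpace α]
    {f : V → W} {v : V} (hf : AnalyticAt ℂ f v) :
    ∃ r > 0, ∃ Φ : (α →ᵇ V) → (α →ᵇ W), AnalyticOnNhd ℂ Φ (ball 0 r) ∧
      ∀ u ∈ ball (0 : α →ᵇ V) r, ∀ a, Φ u a = f (v + u a) := by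
  obtain ⟨p, R, hp⟩ := hf
  -- The power series of `Φ` is that of `f` applied pointwise. Norms of the terms do not grow, so
  -- the radius of convergence does not shrink.
  let q : FormalMultilinearSeries ℂ (α →ᵇ V) (α →ᵇ W) := fun n ↦ (p n).superpose α
  have hq : p.radius ≤ q.radius :=
    FormalMultilinearSeries.radius_le_of_le fun n ↦ (p n).norm_superpose_le
  have hR : 0 < q.radius := hp.r_pos.trans_le (hp.r_le.trans hq)
  have hs := q.hasFPowerSeriesOnBall hR
  obtain ⟨r, hr0, hr⟩ := ENNReal.lt_iff_exists_nnreal_btwn.1 hp.r_pos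
  have hsub : ball (0 : α →ᵇ V) r ⊆ eball 0 q.radius := by
    rw [← Metric.eball_coe]
    exact Metric.eball_subset_eball (hr.le.trans (hp.r_le.trans hq))
  refine ⟨r, by exact_mod_cast hr0, q.sum, hs.analyticOnNhd.mono hsub, fun u hu a ↦ ?_⟩
  -- Evaluation at `a` is continuous and linear, so it turns the sum of `q` at `u` into the series
  -- of `f` at `v + u a`.
  have h1 := hs.hasSum (hsub hu)
  have h2 := h1.mapL (BoundedContinuousFunction.evalCLM ℂ a)
  rw [zero_add] at h2
  refine h2.unique ?_
  refine hp.hasSum (y := u a) ?_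
  refine Metric.eball_subset_eball hr.le ?_
  rw [Metric.eball_coe, mem_ball_zero_iff]
  exact (u.norm_coe_le_norm a).trans_lt (mem_ball_zero_iff.1 hu)

open MeasureTheory

/-- Integration of bounded continuous functions over a set of finite measure. -/
noncomputable def BoundedContinuousFunction.setIntegralCLM {T : Set ℝ} (hT : volume T < ⊤) :
    (ℝ →ᵇ ℂ) →L[ℂ] ℂ :=
  have : IsFiniteMeasure (volume.restrict T) := ⟨by simpa using hT⟩
  LinearMap.mkContinuous
    { toFun u := ∫ t in T, u t
      map_add' u w := integral_add (u.integrable _) (w.integrable _)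
      map_smul' c u := integral_const_mul c _ } (volume.real T) fun u ↦ by
    rw [mul_comm]
    exact norm_setIntegral_le_of_norm_le_const hT fun t _ ↦ u.norm_coe_le_norm t

/-- The map sending `z` to the function `t ↦ F (z, γ t)` is analytic into bounded continuous
functions by superposition, and integration is a continuous linear functional there. Allowing every
measurable `T ⊆ S`, and recording integrability, lets the local pieces be glued over a compact set.
-/
lemma analyticAt_setIntegral_near {E : Type*} [NormedAddCommGroup E] [NormedSpace ℂ E]
    {F : E × ℂ → ℂ} {γ : ℝ → ℂ} (hγ : Continuous γ) {z₀ : E} {t₀ : ℝ}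
    (hF : AnalyticAt ℂ F (z₀, γ t₀)) :
    ∃ S ∈ 𝓝 t₀, ∀ T ⊆ S, MeasurableSet T →
      (∀ᶠ z in 𝓝 z₀, IntegrableOn (fun t ↦ F (z, γ t)) T) ∧
        AnalyticAt ℂ (fun z ↦ ∫ t in T, F (z, γ t)) z₀ := by
  obtain ⟨r, hr, Φ, hΦ, hΦF⟩ := hF.exists_superposition ℝ
  obtain ⟨ε, hε, hε'⟩ := Metric.continuousAt_iff.1 hγ.continuousAt (r / 2) (half_pos hr)
  -- Clipping to an interval around `t₀` makes the curve bounded on all of `ℝ` and within `r / 2` of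
  -- `γ t₀`, without changing it on that interval.
  let clip (t : ℝ) : ℝ := max (t₀ - ε / 2) (min (t₀ + ε / 2) t)
  have hclip (t : ℝ) : dist (clip t) t₀ < ε := by
    rw [Real.dist_eq, abs_lt]
    have h1 : t₀ - ε / 2 ≤ clip t := le_max_left _ _
    have h2 : clip t ≤ t₀ + ε / 2 := max_le (by linarith) (min_le_left _ _)
    constructor <;> linarith
  have hclip' {t : ℝ} (ht : t ∈ Set.Icc (t₀ - ε / 2) (t₀ + ε / 2)) : clip t = t := by
    simp only [clip, min_eq_right ht.2, max_eq_right ht.1]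
  have hb (t : ℝ) : ‖((0 : E), γ (clip t) - γ t₀)‖ ≤ r / 2 := by
    rw [Prod.norm_mk, norm_zero, max_eq_right (norm_nonneg _), ← dist_eq_norm]
    exact (hε' (hclip t)).le
  let u : ℝ →ᵇ E × ℂ := BoundedContinuousFunction.ofNormedAddCommGroup
    (fun t ↦ ((0 : E), γ (clip t) - γ t₀)) (by fun_prop) _ hb
  have hu : u ∈ ball (0 : ℝ →ᵇ E × ℂ) r :=
    mem_ball_zero_iff.2 ((BoundedContinuousFunction.norm_ofNormedAddCommGroup_le _
      (half_pos hr).le hb).trans_lt (half_lt_self hr))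
  -- `L` embeds the parameter space as constant functions, so `L (z - z₀) + u` is the displacement
  -- of `(z, γ (clip t))` from `(z₀, γ t₀)`.
  let L : E →L[ℂ] (ℝ →ᵇ E × ℂ) := LinearMap.mkContinuous
    { toFun z := BoundedContinuousFunction.const ℝ (z, 0)
      map_add' z w := by ext <;> simp
      map_smul' c z := by ext <;> simp } 1 fun z ↦ by
    refine (BoundedContinuousFunction.norm_le (by positivity)).2 fun t ↦ ?_
    simp [Prod.norm_mk]
  have hLu : AnalyticAt ℂ (fun z ↦ L (z - z₀) + u) z₀ :=
    ((L.analyticAt _).comp (analyticAt_id.sub analyticAt_const)).add analyticAt_const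
  have hmem : ∀ᶠ z in 𝓝 z₀, L (z - z₀) + u ∈ ball (0 : ℝ →ᵇ E × ℂ) r :=
    hLu.continuousAt.eventually (isOpen_ball.mem_nhds (by simpa using hu))
  have hΨ : AnalyticAt ℂ (fun z ↦ Φ (L (z - z₀) + u)) z₀ :=
    AnalyticAt.comp (g := Φ) (hΦ _ (by simpa using hu)) hLu
  refine ⟨Set.Icc (t₀ - ε / 2) (t₀ + ε / 2), Icc_mem_nhds (by linarith) (by linarith),
    fun T hT hTm ↦ ?_⟩
  have hTv : volume T < ⊤ := (measure_mono hT).trans_lt measure_Icc_lt_top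
  have : IsFiniteMeasure (volume.restrict T) := ⟨by simpa using hTv⟩
  have hval : ∀ᶠ z in 𝓝 z₀, Set.EqOn (Φ (L (z - z₀) + u)) (fun t ↦ F (z, γ t)) T := by
    filter_upwards [hmem] with z hz t ht
    rw [hΦF _ hz]
    congr 1
    change (z₀, γ t₀) + ((z - z₀, (0 : ℂ)) + ((0 : E), γ (clip t) - γ t₀)) = _
    rw [hclip' (hT ht)]
    simp
  constructor
  · filter_upwards [hval] with z hz
    exact (integrableOn_congr_fun hz hTm).1 ((Φ (L (z - z₀) + u)).integrable _)
  · refine (((BoundedContinuousFunction.setIntegralCLM hTv).analyticAt _).comp hΨ).congr ?_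
    filter_upwards [hval] with z hz
    exact setIntegral_congr_fun hTm hz

/-- The integral of an analytic function depending on a parameter is analytic. -/
lemma analyticAt_setIntegral {E : Type*} [NormedAddCommGroup E] [NormedSpace ℂ E]
    {F : E × ℂ → ℂ} {γ : ℝ → ℂ} (hγ : Continuous γ) {z₀ : E} {K : Set ℝ} (hK : IsCompact K)
    (hF : ∀ t ∈ K, AnalyticAt ℂ F (z₀, γ t)) :
    AnalyticAt ℂ (fun z ↦ ∫ t in K, F (z, γ t)) z₀ := by
  -- Compactness induction. The claim covers all measurable subsets of `S'` so that for a union `A ∪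
  -- B` the domain `T` can be cut into the disjoint pieces `T ∩ A` and `T \ A`.
  have key : ∃ S' ⊇ K, MeasurableSet S' ∧
      ∀ T ⊆ S', MeasurableSet T → (∀ᶠ z in 𝓝 z₀, IntegrableOn (fun t ↦ F (z, γ t)) T) ∧
        AnalyticAt ℂ (fun z ↦ ∫ t in T, F (z, γ t)) z₀ := by
    refine hK.induction_on (p := fun S ↦ ∃ S' ⊇ S, MeasurableSet S' ∧
      ∀ T ⊆ S', MeasurableSet T → (∀ᶠ z in 𝓝 z₀, IntegrableOn (fun t ↦ F (z, γ t)) T) ∧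
        AnalyticAt ℂ (fun z ↦ ∫ t in T, F (z, γ t)) z₀) ?_ ?_ ?_ ?_
    · refine ⟨∅, le_rfl, .empty, fun T hT _ ↦ ?_⟩
      obtain rfl := Set.subset_empty_iff.1 hT
      simpa using analyticAt_const
    · rintro S T h ⟨S', hS', h'⟩
      exact ⟨S', h.trans hS', h'⟩
    · rintro S₁ S₂ ⟨A, hA, hAm, h₁⟩ ⟨B, hB, hBm, h₂⟩
      refine ⟨A ∪ B, Set.union_subset_union hA hB, hAm.union hBm, fun T hT hTm ↦ ?_⟩
      obtain ⟨hi₁, ha₁⟩ := h₁ (T ∩ A) Set.inter_subset_right (hTm.inter hAm)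
      obtain ⟨hi₂, ha₂⟩ := h₂ (T \ A) (fun t ht ↦ (hT ht.1).resolve_left ht.2) (hTm.diff hAm)
      constructor
      · filter_upwards [hi₁, hi₂] with z hz₁ hz₂
        simpa using hz₁.union hz₂
      · refine (ha₁.add ha₂).congr ?_
        filter_upwards [hi₁, hi₂] with z hz₁ hz₂
        exact integral_inter_add_sdiff hAm (by simpa using hz₁.union hz₂)
    · intro t ht
      obtain ⟨ε, hε, h⟩ := Metric.nhds_basis_closedBall.mem_iff.1
        (analyticAt_setIntegral_near hγ (hF t ht)).choose_spec.1
      refine ⟨closedBall t ε, mem_nhdsWithin_of_mem_nhds (closedBall_mem_nhds t hε),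
        closedBall t ε, le_rfl, measurableSet_closedBall, fun T hT ↦ ?_⟩
      exact (analyticAt_setIntegral_near hγ (hF t ht)).choose_spec.2 T (hT.trans h)
  obtain ⟨S, hKS, -, hS⟩ := key
  exact (hS K hKS hK.measurableSet).2

end Superposition

/-! ### Hartogs extension across a point and division by `f` -/

section Hartogs

/-- The diagonal is closed, so a discrepancy at `x` would persist nearby. This carries identities
across thin exceptional sets: the zeros of `f`, or a line through the point. -/
lemma ContinuousAt.eq_of_frequently_eq {X Y : Type*} [TopologicalSpace X] [TopologicalSpace Y]
    [T2Space Y] {u v : X → Y} {x : X} (hu : ContinuousAt u x) (hv : ContinuousAt v x)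
    (h : ∃ᶠ z in 𝓝 x, u z = v z) : u x = v x := by
  by_contra hne
  exact h ((hu.prodMk_nhds hv).eventually (isClosed_diagonal.isOpen_compl.mem_nhds hne))

variable {E : Type*} [NormedAddCommGroup E] [NormedSpace ℂ E]

/-- **Hartogs' theorem** for an isolated point: in dimension at least two, a function which is
analytic on a punctured neighbourhood of a point extends analytically to that point. -/
theorem exists_analyticAt_extension {h : E → ℂ} {x e e' : E} {ℓ : E →L[ℂ] ℂ} (he : ℓ e = 1)
    (he' : ℓ e' = 0) (he'₀ : e' ≠ 0) (hh : ∀ᶠ y in 𝓝[≠] x, AnalyticAt ℂ h y) :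
    ∃ H : E → ℂ, AnalyticAt ℂ H x ∧ ∀ᶠ y in 𝓝[≠] x, H y = h y := by
  obtain ⟨δ, hδ, hhδ⟩ := Metric.eventually_nhds_iff.1 (eventually_nhdsWithin_iff.1 hh)
  have he₀ : e ≠ 0 := by rintro rfl; simp at he
  have hen : 0 < ‖e‖ := norm_pos_iff.2 he₀
  -- With this radius the circle `x + ζ • e`, `|ζ| = R`, stays at distance `δ / 2` from `x`.
  let R : ℝ := δ / (2 * ‖e‖)
  have hR : 0 < R := by positivity
  have hRe : R * ‖e‖ = δ / 2 := by simp only [R]; field_simp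
  -- Cauchy integrand on the line through `z` with direction `e`, parametrised by the `ℓ`-coordinate
  -- `ζ` relative to `x`; `z` itself has parameter `ℓ (z - x)`. The factor `p.2 * I` is the
  -- derivative of the circle.
  let F : E × ℂ → ℂ := fun p ↦
    p.2 * Complex.I * ((p.2 - ℓ (p.1 - x))⁻¹ * h (p.1 + (p.2 - ℓ (p.1 - x)) • e))
  have hF : ∀ t ∈ Set.Icc 0 (2 * Real.pi), AnalyticAt ℂ F (x, circleMap 0 R t) := by
    intro t _
    have h0 : circleMap 0 R t ≠ 0 := circleMap_ne_center hR.ne'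
    have hℓ : AnalyticAt ℂ (fun p : E × ℂ ↦ p.2 - ℓ (p.1 - x)) (x, circleMap 0 R t) :=
      analyticAt_snd.sub ((ℓ.analyticAt _).comp (analyticAt_fst.sub analyticAt_const))
    refine (analyticAt_snd.mul analyticAt_const).mul ((hℓ.inv (by simpa using h0)).mul ?_)
    refine AnalyticAt.comp (g := h) ?_ (analyticAt_fst.add (hℓ.smul analyticAt_const))
    refine hhδ ?_ ?_
    · simp [dist_eq_norm, norm_smul, abs_of_pos hR, hRe]
      linarith
    · simpa [he₀] using h0
  let H : E → ℂ := fun z ↦ (2 * Real.pi * Complex.I)⁻¹ *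
    ∫ t in Set.Icc 0 (2 * Real.pi), F (z, circleMap 0 R t)
  have hH : AnalyticAt ℂ H x :=
    analyticAt_const.mul (analyticAt_setIntegral (continuous_circleMap 0 R) isCompact_Icc hF)
  -- The first bound keeps the whole disk on the line through `z` inside the ball of radius `δ`; the
  -- second puts the parameter of `z` inside the circle.
  have hsmall : ∀ᶠ z in 𝓝 x, ‖z - x‖ + (R + ‖ℓ (z - x)‖) * ‖e‖ < δ ∧ ‖ℓ (z - x)‖ < R := by
    have hc : Continuous fun z : E ↦ ‖z - x‖ + (R + ‖ℓ (z - x)‖) * ‖e‖ := by fun_prop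
    have hc' : Continuous fun z : E ↦ ‖ℓ (z - x)‖ := by fun_prop
    exact (hc.continuousAt.eventually_lt continuousAt_const (by simp [hRe]; linarith)).and
      (hc'.continuousAt.eventually_lt continuousAt_const (by simpa using hR))
  -- When the line through `z` misses `x`, `h` is holomorphic on the whole disk and Cauchy's formula
  -- returns `h z`.
  have key : ∀ᶠ z in 𝓝 x, z - x ≠ ℓ (z - x) • e → H z = h z := by
    filter_upwards [hsmall] with z ⟨hz, hzR⟩ hne
    have hd : DifferentiableOn ℂ (fun ζ : ℂ ↦ h (z + (ζ - ℓ (z - x)) • e)) (closedBall 0 R) := by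
      intro ζ hζ
      refine DifferentiableAt.differentiableWithinAt ?_
      refine DifferentiableAt.comp (g := h) ζ (hhδ ?_ ?_).differentiableAt (by fun_prop)
      · rw [dist_eq_norm]
        refine lt_of_le_of_lt ?_ hz
        rw [add_sub_right_comm]
        refine (norm_add_le _ _).trans ?_
        rw [norm_smul]
        gcongr
        exact (norm_sub_le _ _).trans (by gcongr; simpa using hζ)
      · intro heq
        have h1 : z - x = (ℓ (z - x) - ζ) • e := by
          have : z + (ζ - ℓ (z - x)) • e = x := heq
          rw [← neg_sub ζ, neg_smul, eq_neg_iff_add_eq_zero, sub_add_eq_add_sub, this, sub_self]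
        have h2 := congr(ℓ $h1)
        rw [map_smul, he, smul_eq_mul, mul_one] at h2
        exact hne (h2 ▸ h1)
    have hC := hd.circleIntegral_sub_inv_smul (w := ℓ (z - x)) (by simpa using hzR)
    simp only [H]
    rw [circleIntegral, intervalIntegral.integral_of_le Real.two_pi_pos.le,
      ← MeasureTheory.integral_Icc_eq_integral_Ioc] at hC
    have hI : (∫ t in Set.Icc 0 (2 * Real.pi), F (z, circleMap 0 R t)) =
        (2 * Real.pi * Complex.I) * h z := by
      simpa [F, deriv_circleMap] using hC
    rw [hI, inv_mul_cancel_left₀ Complex.two_pi_I_ne_zero]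
  refine ⟨H, hH, ?_⟩
  have hH' : ∀ᶠ y in 𝓝[≠] x, AnalyticAt ℂ H y := hH.eventually_analyticAt.filter_mono
    nhdsWithin_le_nhds
  filter_upwards [hh, hH', key.eventually_nhds.filter_mono nhdsWithin_le_nhds] with y h1 h2 h3
  refine h2.continuousAt.eq_of_frequently_eq h1.continuousAt ?_
  -- The excluded line `x + ℂ e` has empty interior: since `ℓ e' = 0` and `e' ≠ 0`, any nonzero move
  -- along `e'` leaves it. This is where dimension at least two enters.
  have hfreq : ∃ᶠ z in 𝓝 y, z - x ≠ ℓ (z - x) • e := by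
    by_cases hy : y - x = ℓ (y - x) • e
    · have ht : Tendsto (fun c : ℂ ↦ y + c • e') (𝓝[≠] 0) (𝓝 y) := by
        have : Continuous fun c : ℂ ↦ y + c • e' := by fun_prop
        simpa using (this.tendsto 0).mono_left nhdsWithin_le_nhds
      refine ht.frequently (Eventually.frequently ?_)
      filter_upwards [self_mem_nhdsWithin] with c hc heq
      rw [add_sub_right_comm, map_add, map_smul, he', smul_zero, add_zero, ← hy,
        add_eq_left, smul_eq_zero] at heq
      exact heq.elim hc he'₀
    · have hc : Continuous fun z : E ↦ z - x - ℓ (z - x) • e := by fun_prop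
      refine Eventually.frequently ?_
      filter_upwards [hc.continuousAt.eventually_ne (sub_ne_zero.2 hy)] with z hz
      exact sub_ne_zero.1 hz
  exact (hfreq.and_eventually h3).mono fun z hz ↦ hz.2 hz.1

/-- If `f` has an isolated critical point on `f = 0` and the ambient dimension is at least two,
then divisibility by `f` at all points near `x` implies divisibility at `x`. -/
theorem exists_eq_mul_of_eventually {f g : E → ℂ} {x e e' : E} {ℓ : E →L[ℂ] ℂ} (he : ℓ e = 1)
    (he' : ℓ e' = 0) (he'₀ : e' ≠ 0) (hf : AnalyticAt ℂ f x) (hg : AnalyticAt ℂ g x)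
    (hcrit : ∀ᶠ y in 𝓝[≠] x, f y = 0 → fderiv ℂ f y ≠ 0)
    (hdvd : ∀ᶠ y in 𝓝[≠] x, ∃ k : E → ℂ, AnalyticAt ℂ k y ∧ g =ᶠ[𝓝 y] f * k) :
    ∃ k : E → ℂ, AnalyticAt ℂ k x ∧ g =ᶠ[𝓝 x] f * k := by
  classical
  choose! k hk hgk using fun y (hy : ∃ k : E → ℂ, AnalyticAt ℂ k y ∧ g =ᶠ[𝓝 y] f * k) ↦ hy
  -- If `f` vanished identically near `y`, then both `f` and its derivative would vanish at `y`,
  -- against `hcrit`.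
  have hne : ∀ᶠ y in 𝓝[≠] x, ∃ᶠ z in 𝓝 y, f z ≠ 0 := by
    filter_upwards [hcrit] with y hy h0
    have h0' : f =ᶠ[𝓝 y] 0 := h0.mono fun z hz ↦ not_not.1 hz
    exact hy h0'.eq_of_nhds (by rw [h0'.fderiv_eq]; simp)
  -- A local quotient is determined where `f ≠ 0`, hence everywhere by continuity. So the pointwise
  -- choice `z ↦ k z z` agrees near `y` with the analytic function `k y`.
  have hloc : ∀ᶠ y in 𝓝[≠] x, (fun z ↦ k z z) =ᶠ[𝓝 y] k y := by
    have := (eventually_eventually_nhdsWithin.2 (hdvd.and hne))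
    filter_upwards [this, hdvd, self_mem_nhdsWithin] with y h1 h2 hyx
    rw [isOpen_compl_singleton.nhdsWithin_eq hyx] at h1
    filter_upwards [h1, (hk y h2).eventually_analyticAt, (hgk y h2).eventually_nhds]
      with z ⟨h3, h4⟩ h5 h6
    refine (hk z h3).continuousAt.eq_of_frequently_eq h5.continuousAt ?_
    refine (h4.and_eventually ((hgk z h3).and h6)).mono fun w ⟨hw, h7, h8⟩ ↦ ?_
    exact mul_left_cancel₀ hw (h7.symm.trans h8)
  have hh : ∀ᶠ y in 𝓝[≠] x, AnalyticAt ℂ (fun z ↦ k z z) y := by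
    filter_upwards [hloc, hdvd] with y h1 h2
    exact (hk y h2).congr h1.symm
  obtain ⟨H, hH, hHk⟩ := exists_analyticAt_extension he he' he'₀ hh
  refine ⟨H, hH, ?_⟩
  have hev : ∀ᶠ y in 𝓝[≠] x, g y = (f * H) y := by
    filter_upwards [hdvd, hHk] with y h1 h2
    rw [(hgk y h1).eq_of_nhds, Pi.mul_apply, Pi.mul_apply, h2]
  have : Nontrivial E := ⟨⟨e', 0, he'₀⟩⟩
  have : (𝓝[≠] x).NeBot := Module.punctured_nhds_neBot ℂ E x
  have hx : g x = (f * H) x := hg.continuousAt.eq_of_frequently_eq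
    (hf.continuousAt.mul hH.continuousAt) (hev.frequently.filter_mono nhdsWithin_le_nhds)
  rw [eventually_nhdsWithin_iff] at hev
  filter_upwards [hev] with y hy
  by_cases hyx : y = x
  · rw [hyx, hx]
  · exact hy hyx

end Hartogs

end Analysis

/-! ## Holomorphic functions and one-forms in charts -/

section Charts

open Filter

variable {E : Type*} [NormedAddCommGroup E] [NormedSpace ℂ E]
  {M : Type*} [TopologicalSpace M] [ChartedSpace E M] {p y : M}

lemma eventually_nhds_extChartAt_symm (hy : y ∈ (extChartAt 𝓘(ℂ, E) p).source) {P : M → Prop}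
    (h : ∀ᶠ z in 𝓝 y, P z) :
    ∀ᶠ w in 𝓝 (extChartAt 𝓘(ℂ, E) p y), P ((extChartAt 𝓘(ℂ, E) p).symm w) := by
  have := (continuousAt_extChartAt_symm' (I := 𝓘(ℂ, E)) hy).tendsto
  rw [(extChartAt 𝓘(ℂ, E) p).left_inv hy] at this
  exact this.eventually h

lemma eventually_extChartAt_left_inv (hy : y ∈ (extChartAt 𝓘(ℂ, E) p).source) :
    ∀ᶠ z in 𝓝 y, (extChartAt 𝓘(ℂ, E) p).symm (extChartAt 𝓘(ℂ, E) p z) = z := by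
  filter_upwards [extChartAt_source_mem_nhds' (I := 𝓘(ℂ, E)) hy] with z hz
  exact (extChartAt 𝓘(ℂ, E) p).left_inv hz

lemma HolomorphicAt.congr {g g' : M → ℂ} (hg : HolomorphicAt E g y) (h : g =ᶠ[𝓝 y] g') :
    HolomorphicAt E g' y :=
  ContMDiffAt.congr_of_eventuallyEq hg h.symm

lemma HolomorphicAt.mdifferentiableAt {g : M → ℂ} (hg : HolomorphicAt E g y) :
    MDifferentiableAt 𝓘(ℂ, E) 𝓘(ℂ) g y :=
  ContMDiffAt.mdifferentiableAt hg (by simp)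

/-- The coefficient of the one-form `θ` along the coordinate direction `v` of the chart at `p`. -/
noncomputable def formCoeff (p : M) (v : E) (θ : M → Covector E) (y : M) : ℂ :=
  (show E →L[ℂ] ℂ from θ y)
    ((mfderiv 𝓘(ℂ, E) 𝓘(ℂ, E) (extChartAt 𝓘(ℂ, E) p).symm (extChartAt 𝓘(ℂ, E) p y) :
      E →L[ℂ] E) v)

lemma formCoeff_congr {θ θ' : M → Covector E} (h : θ =ᶠ[𝓝 y] θ') (v : E) :
    formCoeff p v θ =ᶠ[𝓝 y] formCoeff p v θ' :=
  h.mono fun z hz ↦ by simp only [formCoeff, hz]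

lemma formCoeff_smul (g : M → ℂ) (θ : M → Covector E) (v : E) :
    formCoeff p v (g • θ) = g * formCoeff p v θ := rfl

variable [IsManifold 𝓘(ℂ, E) ω M]

lemma contMDiffAt_extChartAt_symm' (hy : y ∈ (extChartAt 𝓘(ℂ, E) p).source) :
    ContMDiffAt 𝓘(ℂ, E) 𝓘(ℂ, E) ω (extChartAt 𝓘(ℂ, E) p).symm (extChartAt 𝓘(ℂ, E) p y) :=
  (contMDiffOn_extChartAt_symm p).contMDiffAt (extChartAt_target_mem_nhds'
    ((extChartAt 𝓘(ℂ, E) p).map_source hy))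

lemma contMDiffAt_extChartAt_of_mem (hy : y ∈ (extChartAt 𝓘(ℂ, E) p).source) :
    ContMDiffAt 𝓘(ℂ, E) 𝓘(ℂ, E) ω (extChartAt 𝓘(ℂ, E) p) y :=
  contMDiffAt_extChartAt' (by rwa [extChartAt_source] at hy)

lemma holomorphicAt_iff_analyticAt (hy : y ∈ (extChartAt 𝓘(ℂ, E) p).source) {g : M → ℂ} :
    HolomorphicAt E g y ↔
      AnalyticAt ℂ (g ∘ (extChartAt 𝓘(ℂ, E) p).symm) (extChartAt 𝓘(ℂ, E) p y) := by
  constructor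
  · intro h
    have h' : ContMDiffAt 𝓘(ℂ, E) 𝓘(ℂ) ω g
        ((extChartAt 𝓘(ℂ, E) p).symm (extChartAt 𝓘(ℂ, E) p y)) := by
      rwa [(extChartAt 𝓘(ℂ, E) p).left_inv hy]
    exact (contMDiffAt_iff_contDiffAt.1 (h'.comp _ (contMDiffAt_extChartAt_symm' hy))).analyticAt
  · intro h
    have h' : HolomorphicAt E ((g ∘ (extChartAt 𝓘(ℂ, E) p).symm) ∘ extChartAt 𝓘(ℂ, E) p) y :=
      ContMDiffAt.comp y (contMDiffAt_iff_contDiffAt.2 h.contDiffAt)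
        (contMDiffAt_extChartAt_of_mem hy)
    refine h'.congr ?_
    filter_upwards [eventually_extChartAt_left_inv hy] with z hz
    exact congr(g $hz)

lemma AnalyticAt.holomorphicAt_comp_extChartAt (hy : y ∈ (extChartAt 𝓘(ℂ, E) p).source)
    {g : E → ℂ} (hg : AnalyticAt ℂ g (extChartAt 𝓘(ℂ, E) p y)) :
    HolomorphicAt E (g ∘ extChartAt 𝓘(ℂ, E) p) y :=
  ContMDiffAt.comp y (contMDiffAt_iff_contDiffAt.2 hg.contDiffAt)
    (contMDiffAt_extChartAt_of_mem hy)

lemma HolomorphicAt.eventually {g : M → ℂ} (hg : HolomorphicAt E g p) :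
    ∀ᶠ z in 𝓝 p, HolomorphicAt E g z := by
  have h := ((holomorphicAt_iff_analyticAt (mem_extChartAt_source p)).1 hg).eventually_analyticAt
  filter_upwards [(continuousAt_extChartAt (I := 𝓘(ℂ, E)) p).eventually h,
    extChartAt_source_mem_nhds (I := 𝓘(ℂ, E)) p] with z hz hzs
  exact (holomorphicAt_iff_analyticAt hzs).2 hz

/-- `differential` is read in the preferred chart at `y`, which changes with `y`. Factoring through
the fixed chart at `p` reduces it to an ordinary derivative on `E`. -/
lemma differential_eq_comp (hy : y ∈ (extChartAt 𝓘(ℂ, E) p).source) {g : M → ℂ}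
    (hg : HolomorphicAt E g y) (v : E) :
    (show E →L[ℂ] ℂ from differential E g y) v =
      fderiv ℂ (g ∘ (extChartAt 𝓘(ℂ, E) p).symm) (extChartAt 𝓘(ℂ, E) p y)
        ((mfderiv 𝓘(ℂ, E) 𝓘(ℂ, E) (extChartAt 𝓘(ℂ, E) p) y : E →L[ℂ] E) v) := by
  have h1 : g =ᶠ[𝓝 y] (g ∘ (extChartAt 𝓘(ℂ, E) p).symm) ∘ extChartAt 𝓘(ℂ, E) p := by
    filter_upwards [eventually_extChartAt_left_inv hy] with z hz
    exact congr(g $hz).symm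
  have ha := (holomorphicAt_iff_analyticAt hy).1 hg
  have h2 : mfderiv 𝓘(ℂ, E) 𝓘(ℂ) g y = _ := h1.mfderiv_eq
  have h3 := mfderiv_comp (I := 𝓘(ℂ, E)) (I' := 𝓘(ℂ, E)) (I'' := 𝓘(ℂ)) y
    (g := g ∘ (extChartAt 𝓘(ℂ, E) p).symm)
    (f := extChartAt 𝓘(ℂ, E) p) ha.differentiableAt.mdifferentiableAt
    ((contMDiffAt_extChartAt_of_mem hy).mdifferentiableAt (by simp))
  rw [mfderiv_eq_fderiv] at h3
  exact congr($(h2.trans h3) v)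

/-- The inverse chart derivative in `formCoeff` cancels the dependence on the preferred chart at
`y`, leaving a partial derivative in the fixed chart at `p`; hence the coefficients vary
holomorphically. -/
lemma formCoeff_differential (hy : y ∈ (extChartAt 𝓘(ℂ, E) p).source) {g : M → ℂ}
    (hg : HolomorphicAt E g y) (v : E) :
    formCoeff p v (differential E g) y =
      fderiv ℂ (g ∘ (extChartAt 𝓘(ℂ, E) p).symm) (extChartAt 𝓘(ℂ, E) p y) v := by
  have hl := (extChartAt 𝓘(ℂ, E) p).left_inv hy
  have h3 := mfderiv_comp_of_eq (I := 𝓘(ℂ, E)) (I' := 𝓘(ℂ, E)) (I'' := 𝓘(ℂ))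
    (g := g) (f := (extChartAt 𝓘(ℂ, E) p).symm) (x := extChartAt 𝓘(ℂ, E) p y)
    (y := y) hg.mdifferentiableAt
    ((contMDiffAt_extChartAt_symm' hy).mdifferentiableAt (by simp)) hl
  rw [mfderiv_eq_fderiv, hl] at h3
  exact congr($h3 v).symm

lemma holomorphicAt_formCoeff_differential (hy : y ∈ (extChartAt 𝓘(ℂ, E) p).source) {g : M → ℂ}
    (hg : HolomorphicAt E g y) (hg' : ∀ᶠ z in 𝓝 y, HolomorphicAt E g z) (v : E) :
    HolomorphicAt E (formCoeff p v (differential E g)) y := by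
  have ha := (holomorphicAt_iff_analyticAt hy).1 hg
  have h1 : AnalyticAt ℂ (fun w ↦ fderiv ℂ (g ∘ (extChartAt 𝓘(ℂ, E) p).symm) w v)
      (extChartAt 𝓘(ℂ, E) p y) :=
    ((ContinuousLinearMap.apply ℂ ℂ v).analyticAt _).comp ha.fderiv
  refine (h1.holomorphicAt_comp_extChartAt hy).congr ?_
  filter_upwards [hg', extChartAt_source_mem_nhds' (I := 𝓘(ℂ, E)) hy] with z hz hzs
  exact (formCoeff_differential hzs hz v).symm

lemma holomorphicAt_formCoeff {θ : M → Covector E}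
    (hθ : (θ : Germ (𝓝 y) (Covector E)) ∈ formGerms E y) (v : E) :
    HolomorphicAt E (formCoeff y v θ) y := by
  -- Induction on the span of differentials. All representatives are quantified over, since a germ
  -- fixes `θ` only near `y`.
  suffices H : ∀ γ ∈ formGerms E y, ∀ θ : M → Covector E, (θ : Germ (𝓝 y) (Covector E)) = γ →
      HolomorphicAt E (formCoeff y v θ) y from H _ hθ _ rfl
  intro γ hγ
  induction hγ using Submodule.span_induction with
  | mem γ h =>
    obtain ⟨g, hg, rfl⟩ := h
    intro θ hθ
    exact (holomorphicAt_formCoeff_differential (mem_extChartAt_source y) hg hg.eventually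
      v).congr (formCoeff_congr (Germ.coe_eq.1 hθ).symm v)
  | zero =>
    intro θ hθ
    have h0 : HolomorphicAt E (0 : M → ℂ) y := contMDiffAt_const
    exact h0.congr (formCoeff_congr (θ := 0) (Germ.coe_eq.1 hθ).symm v)
  | add γ γ' _ _ h h' =>
    induction γ using Germ.inductionOn with | _ η =>
    induction γ' using Germ.inductionOn with | _ η' =>
    intro θ hθ
    have h0 : HolomorphicAt E (formCoeff y v (η + η')) y := ContMDiffAt.add (h η rfl) (h' η' rfl)
    exact h0.congr (formCoeff_congr (Germ.coe_eq.1 hθ).symm v)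
  | smul r γ _ h =>
    induction γ using Germ.inductionOn with | _ η =>
    obtain ⟨_, g, hg, rfl⟩ := r
    intro θ hθ
    have h0 : HolomorphicAt E (formCoeff y v (g • η)) y := ContMDiffAt.mul hg (h η rfl)
    exact h0.congr (formCoeff_congr (Germ.coe_eq.1 hθ).symm v)

/-- At a point where `df ≠ 0`, a function `g` with `g df ∈ f Ω` is a multiple of `f`. -/
lemma exists_eq_mul_of_smul_differential {f g : M → ℂ} {θ : M → Covector E}
    (hf : HolomorphicAt E f y)
    (hθ : (θ : Germ (𝓝 y) (Covector E)) ∈ formGerms E y)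
    (hdf : mfderiv 𝓘(ℂ, E) 𝓘(ℂ) f y ≠ 0)
    (h : g • differential E f =ᶠ[𝓝 y] f • θ) :
    ∃ k : M → ℂ, HolomorphicAt E k y ∧ g =ᶠ[𝓝 y] f * k := by
  have hys := mem_extChartAt_source (I := 𝓘(ℂ, E)) y
  obtain ⟨v, hv⟩ : ∃ v, formCoeff y v (differential E f) y ≠ 0 := by
    by_contra! hv
    refine hdf (ContinuousLinearMap.ext fun v ↦ ?_)
    exact (differential_eq_comp hys hf v).trans
      ((formCoeff_differential hys hf _).symm.trans (hv _))
  have ha := holomorphicAt_formCoeff_differential hys hf hf.eventually v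
  have hb := holomorphicAt_formCoeff hθ v
  have hinv : HolomorphicAt E (formCoeff y v (differential E f))⁻¹ y :=
    ContMDiffAt.inv₀ ha hv
  -- Taking coefficients along `v` gives `g ∂ᵥf = f θᵥ`, and `∂ᵥf` is invertible near `y`.
  refine ⟨formCoeff y v θ * (formCoeff y v (differential E f))⁻¹, ContMDiffAt.mul hb hinv, ?_⟩
  filter_upwards [formCoeff_congr (p := y) h v,
    (ContMDiffAt.continuousAt ha).eventually_ne hv] with z hz hz'
  rw [formCoeff_smul, formCoeff_smul] at hz
  simp only [Pi.mul_apply, Pi.inv_apply] at hz ⊢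
  rw [← mul_assoc, ← hz, mul_inv_cancel_right₀ hz']

/-- If the critical points of `f` on `f = 0` are isolated at `p` and the dimension is at least
two, then divisibility by `f` near `p` outside `p` implies divisibility at `p`. -/
lemma exists_eq_mul_of_eventually_holomorphicAt {f g : M → ℂ} {e e' : E} {ℓ : E →L[ℂ] ℂ}
    (he : ℓ e = 1) (he' : ℓ e' = 0) (he'₀ : e' ≠ 0)
    (hf : HolomorphicAt E f p) (hg : HolomorphicAt E g p)
    (hcrit : ∀ᶠ z in 𝓝[≠] p, f z = 0 → mfderiv 𝓘(ℂ, E) 𝓘(ℂ) f z ≠ 0)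
    (hdvd : ∀ᶠ z in 𝓝[≠] p, ∃ k : M → ℂ, HolomorphicAt E k z ∧ g =ᶠ[𝓝 z] f * k) :
    ∃ k : M → ℂ, HolomorphicAt E k p ∧ g =ᶠ[𝓝 p] f * k := by
  have hps := mem_extChartAt_source (I := 𝓘(ℂ, E)) p
  set φ := extChartAt 𝓘(ℂ, E) p with hφ
  have ht : φ.target ∈ 𝓝 (φ p) := extChartAt_target_mem_nhds p
  have htr {P : M → Prop} (h : ∀ᶠ z in 𝓝[≠] p, P z) : ∀ᶠ w in 𝓝[≠] (φ p), P (φ.symm w) := by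
    rw [eventually_nhdsWithin_iff] at h ⊢
    filter_upwards [eventually_nhds_extChartAt_symm hps h, ht] with w hw hwt hne
    exact hw fun heq ↦ hne (by rw [← φ.right_inv hwt]; exact congr(φ $heq))
  have hnt : ∀ᶠ w in 𝓝[≠] (φ p), w ∈ φ.target := nhdsWithin_le_nhds ht
  have hfe := htr (hf.eventually.filter_mono nhdsWithin_le_nhds)
  have key : ∃ k : E → ℂ, AnalyticAt ℂ k (φ p) ∧
      g ∘ φ.symm =ᶠ[𝓝 (φ p)] (f ∘ φ.symm) * k := by
    refine exists_eq_mul_of_eventually he he' he'₀ ((holomorphicAt_iff_analyticAt hps).1 hf)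
      ((holomorphicAt_iff_analyticAt hps).1 hg) ?_ ?_
    · filter_upwards [htr hcrit, hfe, hnt] with w hw hfw hwt h0 hd
      refine hw h0 (ContinuousLinearMap.ext fun v ↦ ?_)
      refine (differential_eq_comp (φ.map_target hwt) hfw v).trans ?_
      rw [← hφ, φ.right_inv hwt, hd]
      rfl
    · filter_upwards [htr hdvd, hnt] with w ⟨k, hk, hgk⟩ hwt
      have hws := φ.map_target hwt
      have hk' := (holomorphicAt_iff_analyticAt hws).1 hk
      have hgk' := eventually_nhds_extChartAt_symm hws hgk
      rw [← hφ, φ.right_inv hwt] at hk' hgk'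
      exact ⟨k ∘ φ.symm, hk', hgk'⟩
  obtain ⟨k, hk, hgk⟩ := key
  refine ⟨k ∘ φ, hk.holomorphicAt_comp_extChartAt hps, ?_⟩
  filter_upwards [(continuousAt_extChartAt (I := 𝓘(ℂ, E)) p).eventually hgk,
    eventually_extChartAt_left_inv hps] with z hz hz'
  rw [← hφ] at hz hz'
  simpa only [Function.comp_apply, Pi.mul_apply, hz'] using hz

end Charts

/-! ## Vanishing in `H⁰(X, ℰxt¹)` means local splitting -/

section LocalToGlobal

universe w u

/-- A short exact sequence with trivial extension class admits a retraction. -/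
lemma exists_retraction_of_extClass_eq_zero {C : Type*} [Category* C] [Abelian C] [HasExt.{w} C]
    {S : ShortComplex C} (hS : S.ShortExact) (h : hS.extClass = 0) :
    ∃ ρ : S.X₂ ⟶ S.X₁, S.f ≫ ρ = 𝟙 S.X₁ := by
  -- The connecting map sends the identity of `S.X₁` to the extension class. As this is zero, the
  -- identity extends along `S.f`.
  obtain ⟨x, hx⟩ := Abelian.Ext.contravariant_sequence_exact₁ hS S.X₁ (Abelian.Ext.mk₀ (𝟙 S.X₁))
    (add_zero 1) (by rw [h]; simp)
  obtain ⟨ρ, rfl⟩ := (Abelian.Ext.mk₀_bijective _ _).2 x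
  rw [Abelian.Ext.mk₀_comp_mk₀] at hx
  exact ⟨ρ, (Abelian.Ext.mk₀_bijective _ _).1 hx⟩

namespace SheafOfModules

open Abelian

variable {X : TopCat.{u}} {R : Sheaf (Opens.grothendieckTopology X) RingCat.{u}}
  {F G : SheafOfModules.{u} R}

attribute [local instance] HasExt.standard

/-- This yields local injectivity of the sheafification map. The `Ext` groups live one universe
above the opens, so `Opens X` is regarded as essentially small in the larger universe. -/
instance (X : TopCat.{u}) :
    (Opens.grothendieckTopology X).WEqualsLocallyBijective AddCommGrpCat.{u + 1} :=
  have : EssentiallySmall.{u + 1} (Opens X) := essentiallySmall_of_small_of_locallySmall _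
  GrothendieckTopology.WEqualsLocallyBijective.ofEssentiallySmall.{_, _, _, _, u + 1} _

/-- A class in the kernel of `Ext¹(F, G) → H⁰(X, ℰxt¹(F, G))` is locally trivial. -/
lemma exists_mapExactFunctor_eq_zero {α : Ext.{u + 1} F G 1} (hα : localToGlobal F G α = 0)
    (x : X) :
    ∃ U : Opens X, x ∈ U ∧ (α.mapExactFunctor (overFunctor.{u} R U) :
      Ext.{u + 1} (F.over U) (G.over U) 1) = 0 := by
  let β : (extPresheaf F G).obj (op ⊤) := (overFunctor R ⊤).mapExtAddHom F G 1 α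
  have hβ : (toSheafify (Opens.grothendieckTopology X) (extPresheaf F G)).app (op ⊤) β =
      (toSheafify (Opens.grothendieckTopology X) (extPresheaf F G)).app (op ⊤) 0 :=
    hα.trans (map_zero _).symm
  have hS := Presheaf.equalizerSieve_mem (Opens.grothendieckTopology X)
    (toSheafify (Opens.grothendieckTopology X) (extPresheaf F G)) β 0 hβ
  obtain ⟨V, i, hi, hxV⟩ := hS x trivial
  refine ⟨V, hxV, ?_⟩
  have h0 : extRestrict F G i (α.mapExactFunctor (overFunctor.{u} R ⊤)) = 0 :=
    hi.trans (map_zero _)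
  -- `localToGlobal` first restricts to `⊤`; naturality identifies restricting further to `V` with
  -- restricting directly to `V`.
  have h1 := extMap_spec (overMap.{u} R i) ((overFunctorMap R i).app F)
    ((overFunctorMap R i).app G) (α.mapExactFunctor (overFunctor.{u} R ⊤))
  have h2 := mapExactFunctor_naturality (overFunctor.{u} R ⊤ ⋙ overMap.{u} R i)
    (overFunctor.{u} R V) (overFunctorMap R i).hom α
  rw [mapExactFunctor_comp_functor] at h2
  refine mk₀_comp_cancel ((overFunctorMap R i).hom.app F) (h2.symm.trans (h1.symm.trans ?_))
  exact congr((Ext.mk₀ ((overFunctorMap R i).hom.app F)).comp $h0 (zero_add 1))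

/-- A short exact sequence whose class maps to zero in `H⁰(X, ℰxt¹)` splits locally. -/
lemma exists_retraction_of_localToGlobal_eq_zero {S : ShortComplex (SheafOfModules.{u} R)}
    (hS : S.ShortExact) (h : localToGlobal S.X₃ S.X₁ hS.extClass = 0) (x : X) :
    ∃ U : Opens X, x ∈ U ∧ ∃ ρ : S.X₂.over U ⟶ S.X₁.over U, Hom.over S.f U ≫ ρ = 𝟙 _ := by
  obtain ⟨U, hxU, hU⟩ := exists_mapExactFunctor_eq_zero h x
  exact ⟨U, hxU, exists_retraction_of_extClass_eq_zero (hS.map_of_exact (overFunctor.{u} R U))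
    ((Ext.mapExactFunctor_extClass (overFunctor.{u} R U) hS).symm.trans hU)⟩

end SheafOfModules

end LocalToGlobal

/-! ## The conormal sequence -/

section CentralFibre

universe u

namespace Smoothing

open Filter

variable {n : ℕ} {M : Type u} [TopologicalSpace M]
  [ChartedSpace (AffineModel n) M] {𝔛 : Smoothing n M}

lemma ringMk_eq_zero {x : 𝔛.fiber} {g k : M → ℂ}
    {h : (g : Germ (𝓝 (𝔛.pt x)) ℂ) ∈ holGerms (AffineModel n) (𝔛.pt x)}
    (hk : HolomorphicAt (AffineModel n) k (𝔛.pt x)) (hg : g =ᶠ[𝓝 (𝔛.pt x)] 𝔛.f * k) :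
    𝔛.ringMk x ⟨g, h⟩ = 0 := by
  refine Ideal.Quotient.eq_zero_iff_mem.2 (Ideal.mem_span_singleton'.2 ⟨⟨k, k, hk, rfl⟩, ?_⟩)
  rw [mul_comm]
  exact Subtype.ext (Germ.coe_eq.2 hg).symm

/-- The ideal is principal, so an element of `I_x Ω_{M,x}` is a single multiple of `f` rather than a
sum of products. -/
lemma exists_eq_smul_of_formMk_eq_zero {x : 𝔛.fiber} {θ : M → Covector (AffineModel n)}
    {h : (θ : Germ (𝓝 (𝔛.pt x)) (Covector (AffineModel n))) ∈
      formGerms (AffineModel n) (𝔛.pt x)}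
    (h0 : 𝔛.formMk x ⟨θ, h⟩ = 0) :
    ∃ η : M → Covector (AffineModel n), (η : Germ (𝓝 (𝔛.pt x)) (Covector (AffineModel n))) ∈
      formGerms (AffineModel n) (𝔛.pt x) ∧ θ =ᶠ[𝓝 (𝔛.pt x)] 𝔛.f • η := by
  have h1 : (⟨θ, h⟩ : formGerms (AffineModel n) (𝔛.pt x)) ∈ 𝔛.idealSmulForms x :=
    (Submodule.Quotient.mk_eq_zero _).1 h0
  rw [idealSmulForms, idealStalk, Submodule.ideal_span_singleton_smul] at h1
  obtain ⟨⟨η, hη⟩, -, hηθ⟩ := (Submodule.mem_smul_pointwise_iff_exists _ _ _).1 h1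
  induction η using Germ.inductionOn with | _ η =>
  exact ⟨η, hη, (Germ.coe_eq.1 congr(Subtype.val $hηθ)).symm⟩

end Smoothing

end CentralFibre

/-! ### Injectivity of the conormal map and expansion of `dg` in coordinates -/

section CentralFibreCharts

universe u

namespace Smoothing

open Filter

variable {n : ℕ} {M : Type u} [TopologicalSpace M]
  [ChartedSpace (AffineModel n) M] {𝔛 : Smoothing n M}

lemma continuous_pt : Continuous 𝔛.pt := continuous_subtype_val

lemma mfderiv_ne_zero_of_notMem_singularPoints {x : 𝔛.fiber} (hx : x ∉ 𝔛.singularPoints) :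
    mfderiv 𝓘(ℂ, AffineModel n) 𝓘(ℂ) 𝔛.f (𝔛.pt x) ≠ 0 := by
  intro h
  have hs : Function.Surjective (mfderiv 𝓘(ℂ, AffineModel n) 𝓘(ℂ) 𝔛.f (𝔛.pt x)) :=
    not_not.1 hx
  rw [h] at hs
  obtain ⟨v, hv⟩ := hs (show ℂ from 1)
  exact zero_ne_one (α := ℂ) hv

/-- A linear functional to `ℂ` is either surjective or zero. -/
lemma differential_eq_zero_of_mem_singularPoints {x : 𝔛.fiber} (hx : x ∈ 𝔛.singularPoints) :
    differential (AffineModel n) 𝔛.f (𝔛.pt x) = 0 := by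
  by_contra h
  let L : AffineModel n →ₗ[ℂ] ℂ :=
    (show AffineModel n →L[ℂ] ℂ from differential (AffineModel n) 𝔛.f (𝔛.pt x)).toLinearMap
  have hL : L ≠ 0 := fun h0 ↦ h (ContinuousLinearMap.coe_injective h0)
  exact hx (LinearMap.surjective (R := ℂ) (M := AffineModel n) hL)

/-- The value at `x` of an element of `𝒪_{X₀,x}`. -/
noncomputable def evalStalk (x : 𝔛.fiber) : 𝔛.ringStalk x →+* ℂ :=
  Ideal.Quotient.lift (𝔛.idealStalk x)
    (Germ.valueRingHom.comp (holGerms (AffineModel n) (𝔛.pt x)).subtype) fun a ha ↦ by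
      obtain ⟨b, rfl⟩ := Ideal.mem_span_singleton'.1 ha
      rw [map_mul]
      exact mul_eq_zero_of_right _ x.2

variable [IsManifold 𝓘(ℂ, AffineModel n) ω M]

/-- A function annihilating `df` in the stalks of `Ω_M|_{X₀}` near `x` vanishes in `𝒪_{X₀,x}`. -/
lemma exists_eq_mul_of_eventually_smul_df_eq_zero (hn : 1 ≤ n)
    (hiso : 𝔛.HasIsolatedSingularities) {x : 𝔛.fiber} {g : M → ℂ}
    (hg : HolomorphicAt (AffineModel n) g (𝔛.pt x))
    (h : ∀ᶠ y in 𝓝 x, ∃ hy : (g : Germ (𝓝 (𝔛.pt y)) ℂ) ∈ holGerms (AffineModel n) (𝔛.pt y),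
      𝔛.ringMk y ⟨g, hy⟩ • 𝔛.formMk y ⟨differential (AffineModel n) 𝔛.f,
        Submodule.subset_span ⟨𝔛.f, 𝔛.holomorphic _, rfl⟩⟩ = 0) :
    ∃ k : M → ℂ, HolomorphicAt (AffineModel n) k (𝔛.pt x) ∧ g =ᶠ[𝓝 (𝔛.pt x)] 𝔛.f * k := by
  have hreg : ∀ᶠ y in 𝓝 x, y ∉ 𝔛.singularPoints →
      ∃ k : M → ℂ, HolomorphicAt (AffineModel n) k (𝔛.pt y) ∧
        g =ᶠ[𝓝 (𝔛.pt y)] 𝔛.f * k := by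
    filter_upwards [h] with y ⟨hy, h0⟩ hys
    rw [← formMk_smul] at h0
    obtain ⟨η, hη, hηf⟩ := exists_eq_smul_of_formMk_eq_zero
      (θ := g • differential (AffineModel n) 𝔛.f) (h := Submodule.smul_mem _
        (⟨g, hy⟩ : holGerms (AffineModel n) (𝔛.pt y))
        (Submodule.subset_span (s := {γ | ∃ g : M → ℂ, HolomorphicAt (AffineModel n) g (𝔛.pt y) ∧
          (differential (AffineModel n) g : Germ (𝓝 (𝔛.pt y)) (Covector (AffineModel n))) = γ})
          ⟨𝔛.f, 𝔛.holomorphic _, rfl⟩)) h0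
    exact exists_eq_mul_of_smul_differential (𝔛.holomorphic _) hη
      (mfderiv_ne_zero_of_notMem_singularPoints hys) hηf
  by_cases hx : x ∈ 𝔛.singularPoints
  · have hpunct : ∀ᶠ y in 𝓝[≠] x, mfderiv 𝓘(ℂ, AffineModel n) 𝓘(ℂ) 𝔛.f (𝔛.pt y) ≠ 0 ∧
        ∃ k : M → ℂ, HolomorphicAt (AffineModel n) k (𝔛.pt y) ∧
          g =ᶠ[𝓝 (𝔛.pt y)] 𝔛.f * k := by
      filter_upwards [hreg.filter_mono nhdsWithin_le_nhds, hiso x hx] with y hy hys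
      exact ⟨mfderiv_ne_zero_of_notMem_singularPoints hys, hy hys⟩
    -- Isolatedness is a condition on `X₀`; here it is transferred to a punctured neighbourhood in
    -- `M`, restricted to points with `f z = 0`.
    have hM : ∀ᶠ z in 𝓝[≠] (𝔛.pt x), 𝔛.f z = 0 →
        mfderiv 𝓘(ℂ, AffineModel n) 𝓘(ℂ) 𝔛.f z ≠ 0 ∧
        ∃ k : M → ℂ, HolomorphicAt (AffineModel n) k z ∧ g =ᶠ[𝓝 z] 𝔛.f * k := by
      rw [eventually_nhdsWithin_iff] at hpunct ⊢
      have h1 : ∀ᶠ y in 𝓝 x, 𝔛.pt y ≠ 𝔛.pt x →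
          mfderiv 𝓘(ℂ, AffineModel n) 𝓘(ℂ) 𝔛.f (𝔛.pt y) ≠ 0 ∧
          ∃ k : M → ℂ, HolomorphicAt (AffineModel n) k (𝔛.pt y) ∧
            g =ᶠ[𝓝 (𝔛.pt y)] 𝔛.f * k :=
        hpunct.mono fun y hy hne ↦ hy fun heq ↦ hne (by rw [heq])
      have h2 := eventually_nhdsWithin_iff.1
        ((eventually_nhds_subtype_iff {z | 𝔛.f z = 0} x fun z ↦ z ≠ 𝔛.pt x →
          mfderiv 𝓘(ℂ, AffineModel n) 𝓘(ℂ) 𝔛.f z ≠ 0 ∧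
          ∃ k : M → ℂ, HolomorphicAt (AffineModel n) k z ∧ g =ᶠ[𝓝 z] 𝔛.f * k).1 h1)
      exact h2.mono fun z hz hne h0 ↦ hz h0 hne
    -- A second coordinate direction exists because `n ≥ 1`; it supplies `e'` in Hartogs' theorem,
    -- with `ℓ` the zeroth coordinate.
    let i : Fin (n + 1) := ⟨1, by lia⟩
    have hi : (0 : Fin (n + 1)) ≠ i := by simp [i, Fin.ext_iff]
    refine exists_eq_mul_of_eventually_holomorphicAt
      (e := EuclideanSpace.single 0 1) (e' := EuclideanSpace.single i 1)
      (ℓ := EuclideanSpace.proj (0 : Fin (n + 1))) (by simp) (by simp [hi])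
      (by simp) (𝔛.holomorphic _) hg (hM.mono fun z hz h0 ↦ (hz h0).1) ?_
    filter_upwards [hM, hg.eventually.filter_mono nhdsWithin_le_nhds] with z hz hgz
    by_cases h0 : 𝔛.f z = 0
    · exact (hz h0).2
    -- Off the central fibre `f` is a unit, so divisibility is automatic.
    · have hinv : HolomorphicAt (AffineModel n) 𝔛.f⁻¹ z := ContMDiffAt.inv₀ (𝔛.holomorphic z) h0
      refine ⟨𝔛.f⁻¹ * g, ContMDiffAt.mul hinv hgz, ?_⟩
      filter_upwards [(ContMDiffAt.continuousAt (𝔛.holomorphic z)).eventually_ne h0] with w hw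
      simp [hw]
  · exact hreg.self_of_nhds hx

/-- Sections are families of stalk elements, so vanishing is checked at each `x`. Near `x` one
function `g` represents the section, and the division result applies to it. -/
lemma conormalMap_injective (hn : 1 ≤ n) (hiso : 𝔛.HasIsolatedSingularities)
    (U : (Opens 𝔛.fiber)ᵒᵖ) : Function.Injective (𝔛.conormalMap.val.app U) := by
  refine (injective_iff_map_eq_zero _).2 fun (s : 𝔛.sectionRing U.unop) hs ↦ ?_
  have hs' : ∀ x : U.unop, s.1 x • 𝔛.formMk x.1 ⟨differential (AffineModel n) 𝔛.f,
      Submodule.subset_span ⟨𝔛.f, 𝔛.holomorphic _, rfl⟩⟩ = 0 := fun x ↦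
    congr_fun (congr_arg Subtype.val hs) x
  refine Subtype.ext (funext fun x ↦ ?_)
  obtain ⟨g, hg⟩ := s.2 x
  obtain ⟨hgx, hsx⟩ := hg.self_of_nhds
  have hloc : ∀ᶠ y in 𝓝 x.1, ∃ hy : (g : Germ (𝓝 (𝔛.pt y)) ℂ) ∈
      holGerms (AffineModel n) (𝔛.pt y),
      𝔛.ringMk y ⟨g, hy⟩ • 𝔛.formMk y ⟨differential (AffineModel n) 𝔛.f,
        Submodule.subset_span ⟨𝔛.f, 𝔛.holomorphic _, rfl⟩⟩ = 0 := by
    rw [← U.unop.isOpenEmbedding'.map_nhds_eq x, eventually_map]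
    filter_upwards [hg] with y ⟨hy, hsy⟩
    exact ⟨hy, by rw [← hsy]; exact hs' y⟩
  obtain ⟨g', hg', hgg'⟩ := hgx
  have hgh : HolomorphicAt (AffineModel n) g (𝔛.pt x.1) := hg'.congr (Germ.coe_eq.1 hgg')
  obtain ⟨k, hk, hgk⟩ := exists_eq_mul_of_eventually_smul_df_eq_zero hn hiso hgh hloc
  rw [hsx]
  exact ringMk_eq_zero hk hgk

/-- Only injectivity has content: `Ω_{X₀}` is by definition the cokernel. -/
lemma conormalSequence_shortExact (hn : 1 ≤ n) (hiso : 𝔛.HasIsolatedSingularities) :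
    𝔛.conormalSequence.ShortExact where
  exact := ShortComplex.exact_cokernel _
  mono_f := SheafOfModules.mono_of_injective_app _ (conormalMap_injective hn hiso)
  epi_g := inferInstanceAs (Epi (cokernel.π 𝔛.conormalMap))

/-- The open part of `X₀` covered by the preferred chart at `p`. -/
def chartOpen (p : 𝔛.fiber) : Opens 𝔛.fiber :=
  ⟨𝔛.pt ⁻¹' (extChartAt 𝓘(ℂ, AffineModel n) (𝔛.pt p)).source,
    (isOpen_extChartAt_source (𝔛.pt p)).preimage continuous_pt⟩

end Smoothing

section

variable {n : ℕ} {M : Type*} [TopologicalSpace M] [ChartedSpace (AffineModel n) M]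

/-- The `i`-th coordinate function of the preferred chart at `p`. -/
noncomputable def chartCoord (p : M) (i : Fin (n + 1)) : M → ℂ :=
  EuclideanSpace.proj (𝕜 := ℂ) i ∘ extChartAt 𝓘(ℂ, AffineModel n) p

variable [IsManifold 𝓘(ℂ, AffineModel n) ω M] {p y : M}

lemma holomorphicAt_chartCoord (hy : y ∈ (extChartAt 𝓘(ℂ, AffineModel n) p).source)
    (i : Fin (n + 1)) : HolomorphicAt (AffineModel n) (chartCoord p i) y :=
  (ContinuousLinearMap.analyticAt _ _).holomorphicAt_comp_extChartAt hy

/-- Chain rule in the fixed chart at `p`. Holding at every `y` of the chart domain, with the same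
functions as coefficients, it gives an identity of germs and not only of values at `p`. -/
lemma differential_eq_sum (hy : y ∈ (extChartAt 𝓘(ℂ, AffineModel n) p).source) {g : M → ℂ}
    (hg : HolomorphicAt (AffineModel n) g y) :
    differential (AffineModel n) g y = ∑ i, formCoeff p (EuclideanSpace.single i 1)
      (differential (AffineModel n) g) y • differential (AffineModel n) (chartCoord p i) y := by
  have hcoord (i : Fin (n + 1)) : chartCoord p i ∘ (extChartAt 𝓘(ℂ, AffineModel n) p).symm
      =ᶠ[𝓝 (extChartAt 𝓘(ℂ, AffineModel n) p y)] EuclideanSpace.proj (𝕜 := ℂ) i := by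
    filter_upwards [extChartAt_target_mem_nhds'
      ((extChartAt 𝓘(ℂ, AffineModel n) p).map_source hy)] with w hw
    simp only [chartCoord, Function.comp_apply, (extChartAt 𝓘(ℂ, AffineModel n) p).right_inv hw]
  refine ContinuousLinearMap.ext fun v ↦ ?_
  refine (differential_eq_comp hy hg v).trans ?_
  let D (i : Fin (n + 1)) : AffineModel n →L[ℂ] ℂ :=
    differential (AffineModel n) (chartCoord p i) y
  let c (i : Fin (n + 1)) : ℂ :=
    formCoeff p (EuclideanSpace.single i 1) (differential (AffineModel n) g) y
  have hsum : (∑ i, c i • D i) v = ∑ i, c i * D i v := by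
    simp [_root_.sum_apply]
  refine Eq.trans ?_ hsum.symm
  -- `w` is the tangent vector `v` read in the chart at `p`; its coordinates are the values
  -- `dzᵢ(v)`.
  obtain ⟨w, hw⟩ : ∃ w : AffineModel n, w = (mfderiv 𝓘(ℂ, AffineModel n) 𝓘(ℂ, AffineModel n)
    (extChartAt 𝓘(ℂ, AffineModel n) p) y : AffineModel n →L[ℂ] AffineModel n) v := ⟨_, rfl⟩
  have hdz (i : Fin (n + 1)) : D i v = w i := by
    refine (differential_eq_comp hy (holomorphicAt_chartCoord hy i) v).trans ?_
    rw [(hcoord i).fderiv_eq, ← hw, ContinuousLinearMap.fderiv]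
    rfl
  have hwsum : w = ∑ i, w i • EuclideanSpace.single i (1 : ℂ) := by
    ext j
    simp [Finset.sum_apply, Pi.single_apply]
  rw [← hw]
  conv_lhs => rw [hwsum, map_sum]
  refine Finset.sum_congr rfl fun i _ ↦ ?_
  simp only [c]
  rw [hdz, formCoeff_differential hy hg, map_smul, smul_eq_mul, mul_comm]

end

end CentralFibreCharts

/-! ## The conormal sequence does not split at a singular point -/

section Splitting

universe u

namespace Smoothing

open Filter

variable {n : ℕ} {M : Type u} [TopologicalSpace M]
  [ChartedSpace (AffineModel n) M] {𝔛 : Smoothing n M} [IsManifold 𝓘(ℂ, AffineModel n) ω M]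

/-- In a chart at a point `p`, the form `df` is a combination of forms whose coefficients are the
partial derivatives of `f`. -/
lemma exists_df_eq_sum (p : 𝔛.fiber) {V : Opens 𝔛.fiber} (hV : V ≤ chartOpen p) :
    ∃ (c : Fin (n + 1) → 𝔛.sectionRing V) (ζ : Fin (n + 1) → 𝔛.sectionModule V),
      (show 𝔛.sectionModule V from 𝔛.df.eval (op V)) = ∑ i, c i • ζ i ∧
      ∀ (hp : p ∈ V), p ∈ 𝔛.singularPoints → ∀ i, evalStalk p ((c i).1 ⟨p, hp⟩) = 0 := by
  let a (i : Fin (n + 1)) : M → ℂ := formCoeff (𝔛.pt p) (EuclideanSpace.single i 1)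
    (differential (AffineModel n) 𝔛.f)
  have ha (i : Fin (n + 1)) (y : V) : HolomorphicAt (AffineModel n) (a i) (𝔛.pt y.1) :=
    holomorphicAt_formCoeff_differential (hV y.2) (𝔛.holomorphic _) (.of_forall 𝔛.holomorphic) _
  have hz (i : Fin (n + 1)) (y : V) :
      HolomorphicAt (AffineModel n) (chartCoord (𝔛.pt p) i) (𝔛.pt y.1) :=
    holomorphicAt_chartCoord (hV y.2) i
  refine ⟨fun i ↦ ⟨fun y ↦ 𝔛.ringMk y.1 ⟨a i, a i, ha i y, rfl⟩,
      fun _ ↦ ⟨a i, .of_forall fun y ↦ ⟨⟨a i, ha i y, rfl⟩, rfl⟩⟩⟩,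
    fun i ↦ ⟨fun y ↦ 𝔛.formMk y.1 ⟨differential (AffineModel n) (chartCoord (𝔛.pt p) i),
      Submodule.subset_span ⟨_, hz i y, rfl⟩⟩,
      fun _ ↦ ⟨differential (AffineModel n) (chartCoord (𝔛.pt p) i), .of_forall fun y ↦
        ⟨Submodule.subset_span ⟨_, hz i y, rfl⟩, rfl⟩⟩⟩, ?_, ?_⟩
  · refine Subtype.ext (funext fun y ↦ ?_)
    rw [AddSubmonoidClass.coe_finsetSum, Finset.sum_apply]
    change 𝔛.formMk y.1 _ = ∑ i, 𝔛.ringMk y.1 _ • 𝔛.formMk y.1 _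
    simp only [← formMk_smul]
    rw [← map_sum]
    congr 1
    refine Subtype.ext ?_
    rw [AddSubmonoidClass.coe_finsetSum]
    have hsum : ((∑ i, a i • differential (AffineModel n) (chartCoord (𝔛.pt p) i) :
        M → Covector (AffineModel n)) : Germ (𝓝 (𝔛.pt y.1)) (Covector (AffineModel n))) =
        ∑ i, ((a i • differential (AffineModel n) (chartCoord (𝔛.pt p) i) :
          M → Covector (AffineModel n)) : Germ (𝓝 (𝔛.pt y.1)) (Covector (AffineModel n))) :=
      map_sum (Germ.coeAddHom (𝓝 (𝔛.pt y.1))) _ _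
    refine Eq.trans ?_ hsum
    refine Germ.coe_eq.2 ?_
    filter_upwards [(isOpen_extChartAt_source (I := 𝓘(ℂ, AffineModel n))
      (𝔛.pt p)).mem_nhds (hV y.2)] with z hzs
    rw [Finset.sum_apply]
    exact differential_eq_sum hzs (𝔛.holomorphic z)
  · intro hp hps i
    -- The value of `c i` at `p` is `∂f/∂zᵢ(p)`, which vanishes because `df` does.
    change formCoeff _ _ _ _ = 0
    rw [formCoeff, differential_eq_zero_of_mem_singularPoints hps]
    rfl

/-- The conormal sequence does not split in any neighbourhood of a singular point. -/
lemma conormalMap_over_comp_ne_id {p : 𝔛.fiber} (hp : p ∈ 𝔛.singularPoints)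
    {U : Opens 𝔛.fiber} (hpU : p ∈ U)
    (ρ : 𝔛.ambientForms.over U ⟶ 𝔛.structureSheaf.over U) :
    SheafOfModules.Hom.over 𝔛.conormalMap U ≫ ρ ≠ 𝟙 _ := by
  intro hρ
  let V : Opens 𝔛.fiber := U ⊓ chartOpen p
  have hpV : p ∈ V := ⟨hpU, mem_extChartAt_source (𝔛.pt p)⟩
  let W : (Over U)ᵒᵖ := op (Over.mk (homOfLE inf_le_left : V ⟶ U))
  let L : 𝔛.sectionModule V →ₗ[𝔛.sectionRing V] 𝔛.sectionRing V := (ρ.val.app W).hom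
  obtain ⟨c, ζ, hdf, hc⟩ := exists_df_eq_sum p (V := V) inf_le_right
  -- The conormal map sends `1` to `df`, so a retraction must send `df` back to `1`.
  have h1 : L (show 𝔛.sectionModule V from 𝔛.df.eval (op V)) = 1 := by
    have h2 := congr(($hρ).val.app W (1 : 𝔛.sectionRing V))
    have h3 : 𝔛.conormalMap.val.app (op V) (1 : 𝔛.sectionRing V) = 𝔛.df.eval (op V) :=
      one_smul (𝔛.sectionRing V) (show 𝔛.sectionModule V from 𝔛.df.eval (op V))
    exact (congr_arg L h3).symm.trans h2
  rw [hdf, map_sum] at h1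
  -- By linearity `1 = ∑ cᵢ L(ζᵢ)`, and each `cᵢ` vanishes at `p`.
  have h4 : evalStalk p ((1 : 𝔛.sectionRing V).1 ⟨p, hpV⟩) = 0 := by
    rw [← h1, AddSubmonoidClass.coe_finsetSum, Finset.sum_apply, map_sum]
    refine Finset.sum_eq_zero fun i _ ↦ ?_
    rw [map_smul]
    refine (map_mul (evalStalk p) ((c i).1 ⟨p, hpV⟩) ((L (ζ i)).1 ⟨p, hpV⟩)).trans ?_
    rw [hc hpV hp i, zero_mul]
  exact one_ne_zero ((map_one (evalStalk p)).symm.trans h4)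

end Smoothing

end Splitting

/-! ### The main theorem -/

theorem proposition3p2 {n : ℕ} (hn : 1 ≤ n) {M : Type*} [TopologicalSpace M]
    [ChartedSpace (EuclideanSpace ℂ (Fin (n + 1))) M]
    [IsManifold 𝓘(ℂ, EuclideanSpace ℂ (Fin (n + 1))) ω M]
    (𝔛 : Smoothing n M) (hsing : 𝔛.singularPoints.Nonempty)
    (hiso : 𝔛.HasIsolatedSingularities) :
    ∃ h : 𝔛.conormalSequence.ShortExact,
      SheafOfModules.localToGlobal 𝔛.kaehlerForms 𝔛.structureSheaf
        (𝔛.kodairaSpencerClass h) ≠ 0 := by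
  have h := Smoothing.conormalSequence_shortExact (𝔛 := 𝔛) hn hiso
  refine ⟨h, fun h0 ↦ ?_⟩
  obtain ⟨p, hp⟩ := hsing
  obtain ⟨U, hpU, ρ, hρ⟩ := SheafOfModules.exists_retraction_of_localToGlobal_eq_zero h h0 p
  exact Smoothing.conormalMap_over_comp_ne_id hp hpU ρ hρ
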